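/- Let $f:\mathbb R\to\mathbb R$ be differentiable, $L$-Lipschitz smooth ($|f'(x)-f'(y)|\le L|x-y|$ for all $x,y$), $\mu$-strongly convex for some $\mu>0$ ($f(y)\ge f(x)+f'(x)(y-x)+\tfrac{\mu}{2}|x-y|^2$ for all $x,y$) and bounded from below. For every $n\in\mathbb N$ let $b_n,c_n\in\mathbb R^n$ be (deterministic) vectors such that $\|b_n\|_\infty,\|b_n\|_1,\|c_n\|_\infty,\|c_n\|_1=\Theta(1)$ as $n\to\infty$, and let $G_n$ be a random $n\times n$ real matrix whose entries are independent standard normal variables. Consider the family of physical design problems $(f,c_n,(A_n,B_n,b_n))$, i.e. of minimizing $f\big(c_n^{\mathrm T}(A_n+\operatorname{diag}(B_n\theta))^{-1}b_n\big)$ over $\theta$, with $A_n:=G_n^{-1}$ and $B_n:=I_n$. Let $\odot$ be the entrywise product of vectors, and $\|\cdot\|_p$ the $l^p$ norm of vectors and the induced $l^p$ norm of matrices. Then $G_n$ is almost surely invertible for every $n$, and: (a) for every $n$ and every $\varepsilon>0$, with probability at least $1-2\exp(-\varepsilon^2/2)$, $\|A_n^{-1}\|_2\le 2\sqrt n+\varepsilon$;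 (b) $\mathrm E\big(\|B_n^{\mathrm T}(A_n^{-1}b_n\odot A_n^{-\mathrm T}c_n)\|_2^2\big)$ is finite for every $n$ and is $\ge\Omega(n)$ as $n\to\infty$; (c) $\mathrm E\big(|c_n^{\mathrm T}A_n^{-1}b_n|^2\big)$ is finite for every $n$ and is $\le O(1)$ as $n\to\infty$. Moreover, with $\alpha=\gamma=1/2$, the family satisfies the $(\alpha,\gamma)$-asymptotic convergence conditions on average, that is: $f$ is Lipschitz smooth, strongly convex and bounded from below; $A_n$ is almost surely invertible; $\mathrm E\|A_n^{-1}\|_2\le O(n^{\gamma})$; $\|B_n\|_\infty,\|B_n\|_1,\|B_n\|_2\le O(1)$; $\|b_n\|_\infty,\|b_n\|_1\le O(1)$; $\|c_n\|_\infty,\|c_n\|_1\le O(1)$; $\mathrm E\big(\|B_n^{\mathrm T}(A_n^{-1}b_n\odot A_n^{-\mathrm T}c_n)\|_2^2\big)\ge\Omega(n^{\alpha+\gamma})$; and $\mathrm E|c_n^{\mathrm T}A_n^{-1}b_n|\le O(1)$, where all these expectations are finite for every $n$. -/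

import Mathlib

open MeasureTheory ProbabilityTheory Filter Asymptotics
open scoped Matrix NNReal ENNReal

noncomputable section

/-- The `l^p` norm of a real vector. -/
def vecNorm (p : ℝ≥0∞) {n : ℕ} (v : Fin n → ℝ) : ℝ := ‖WithLp.toLp p v‖

/-- The induced `l^p` norm `sup_{v ≠ 0} ‖M v‖_p / ‖v‖_p` of a real matrix, as the operator norm of
`v ↦ M v` between the `l^p` spaces. -/
def matNorm (p : ℝ≥0∞) [Fact (1 ≤ p)] {n m : ℕ} (M : Matrix (Fin n) (Fin m) ℝ) : ℝ :=
  ‖(Matrix.toLpLin p p M).toContinuousLinearMap‖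

/-- The data `(A, B, b)` of a physical system with state size `n` and parameter size `m`:
physics matrix, selection matrix and source vector. -/
structure PhysicalSystem (n m : ℕ) where
  A : Matrix (Fin n) (Fin n) ℝ
  B : Matrix (Fin n) (Fin m) ℝ
  b : Fin n → ℝ

/-- The vector `Bᵀ (A⁻¹ b ⊙ A⁻ᵀ c)`: up to the factor `-f'(cᵀ A⁻¹ b)`, the gradient at `θ = 0` of
`θ ↦ f (cᵀ (A + diag (B θ))⁻¹ b)`. (`*` on `Fin n → ℝ` is the entrywise product.) -/
def PhysicalSystem.gradVec {n m : ℕ} (φ : PhysicalSystem n m) (c : Fin n → ℝ) : Fin m → ℝ :=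
  φ.Bᵀ *ᵥ ((φ.A⁻¹ *ᵥ φ.b) * ((φ.A⁻¹)ᵀ *ᵥ c))

/-- The number `cᵀ A⁻¹ b`. -/
def PhysicalSystem.overlap {n m : ℕ} (φ : PhysicalSystem n m) (c : Fin n → ℝ) : ℝ :=
  c ⬝ᵥ (φ.A⁻¹ *ᵥ φ.b)

/-- `f` is differentiable, `L`-Lipschitz smooth, `μ`-strongly convex and bounded from below. -/
structure IsAdmissibleCost (f : ℝ → ℝ) (L : ℝ≥0) (μ : ℝ) : Prop where
  differentiable : Differentiable ℝ f
  smooth : LipschitzWith L (deriv f)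
  pos : 0 < μ
  strongConvex : ∀ x y : ℝ, f x + deriv f x * (y - x) + μ * |x - y| ^ 2 / 2 ≤ f y
  bddBelow : BddBelow (Set.range f)

/-- A family of physical design problems `(f, c_n, (A_n, B_n, b_n))`, one for every state size `n`,
with parameter sizes `m n`, a common cost function `f`, and random physics matrices `A_n`. -/
structure RandomDesignFamily (Ω : Type*) (m : ℕ → ℕ) where
  f : ℝ → ℝ
  c : ∀ n, Fin n → ℝ
  A : ∀ n, Ω → Matrix (Fin n) (Fin n) ℝ
  B : ∀ n, Matrix (Fin n) (Fin (m n)) ℝ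
  b : ∀ n, Fin n → ℝ

/-- The physical system of state size `n` at the sample point `ω`. -/
def RandomDesignFamily.sys {Ω : Type*} {m : ℕ → ℕ} (F : RandomDesignFamily Ω m) (n : ℕ) (ω : Ω) :
    PhysicalSystem n (m n) := ⟨F.A n ω, F.B n, F.b n⟩

/-- The family satisfies the `(α, γ)`-asymptotic convergence conditions on average: in each
condition that involves the random physics matrix, namely `‖A_n⁻¹‖₂ ≤ O(n^γ)`,
`‖B_nᵀ (A_n⁻¹ b_n ⊙ A_n⁻ᵀ c_n)‖₂² ≥ Ω(n^(α+γ))` and `|c_nᵀ A_n⁻¹ b_n| ≤ O(1)`, the random quantity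
is integrable and the bound holds for its expectation. -/
structure RandomDesignFamily.ConvergenceConditionsOnAverage {Ω : Type*} [MeasurableSpace Ω]
    {m : ℕ → ℕ} (F : RandomDesignFamily Ω m) (P : Measure Ω) (α γ : ℝ) : Prop where
  cost : ∃ (L : ℝ≥0) (μ : ℝ), IsAdmissibleCost F.f L μ
  invertible : ∀ n, ∀ᵐ ω ∂P, IsUnit (F.A n ω)
  inv_integrable : ∀ n, Integrable (fun ω => matNorm 2 (F.A n ω)⁻¹) P
  inv_bound : (fun n => ∫ ω, matNorm 2 (F.A n ω)⁻¹ ∂P) =O[atTop] fun n : ℕ => (n : ℝ) ^ γ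
  B_infty : (fun n => matNorm ∞ (F.B n)) =O[atTop] fun _ => (1 : ℝ)
  B_one : (fun n => matNorm 1 (F.B n)) =O[atTop] fun _ => (1 : ℝ)
  B_two : (fun n => matNorm 2 (F.B n)) =O[atTop] fun _ => (1 : ℝ)
  b_infty : (fun n => vecNorm ∞ (F.b n)) =O[atTop] fun _ => (1 : ℝ)
  b_one : (fun n => vecNorm 1 (F.b n)) =O[atTop] fun _ => (1 : ℝ)
  c_infty : (fun n => vecNorm ∞ (F.c n)) =O[atTop] fun _ => (1 : ℝ)
  c_one : (fun n => vecNorm 1 (F.c n)) =O[atTop] fun _ => (1 : ℝ)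
  grad_integrable : ∀ n, Integrable (fun ω => vecNorm 2 ((F.sys n ω).gradVec (F.c n)) ^ 2) P
  grad_bound : (fun n : ℕ => (n : ℝ) ^ (α + γ)) =O[atTop]
    fun n => ∫ ω, vecNorm 2 ((F.sys n ω).gradVec (F.c n)) ^ 2 ∂P
  overlap_integrable : ∀ n, Integrable (fun ω => |(F.sys n ω).overlap (F.c n)|) P
  overlap_bound : (fun n => ∫ ω, |(F.sys n ω).overlap (F.c n)| ∂P) =O[atTop] fun _ => (1 : ℝ)

/-- `G` is a random `n × n` matrix whose entries are independent standard normal variables. -/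
structure IsStdGaussianMatrix {Ω : Type*} [MeasurableSpace Ω] (P : Measure Ω) {n : ℕ}
    (G : Ω → Matrix (Fin n) (Fin n) ℝ) : Prop where
  law : ∀ i j, HasLaw (fun ω => G ω i j) (gaussianReal 0 1) P
  indep : iIndepFun (fun (ij : Fin n × Fin n) ω => G ω ij.1 ij.2) P

/-- The family with physics matrices `A_n = G_n⁻¹`, selection matrices `B_n = I_n`, source vectors
`b_n` and overlap vectors `c_n`. -/
def gaussianFamily {Ω : Type*} (f : ℝ → ℝ) (b c : ∀ n, Fin n → ℝ)
    (G : ∀ n, Ω → Matrix (Fin n) (Fin n) ℝ) : RandomDesignFamily Ω (fun n => n) where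
  f := f
  c := c
  A := fun n ω => (G n ω)⁻¹
  B := fun _ => 1
  b := b

end

/-!
Write `G` for the Gaussian matrix whose inverse is the physics matrix. Indexed by the pairs
`(u, v)` of unit vectors, the process `uᵀ G v + ξ` with an extra independent standard normal
variable `ξ` and the process `⟨u, g⟩ + ⟨v, h⟩` with independent standard Gaussian vectors `g`, `h`
have equal variances, and the covariances of the first exceed those of the second by
`(1 - ⟨u, u'⟩) (1 - ⟨v, v'⟩) ≥ 0`. Kahane's interpolation, applied to powers of `∑ exp`, therefore
bounds the moment generating function of `‖G‖ = sup uᵀ G v`, times that of `ξ`, by that of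
`|g| + |h|`. This gives `E exp (l ‖G‖) ≤ exp (2 l √n + l² / 2)`; the tail bound follows by
Chernoff's inequality and the bound on the mean by Jensen's.

The gradient and the overlap are polynomials in Gaussian linear forms, whose moments come from
Stein's identity. Finally `G` is almost surely invertible because `t ↦ det (M + t I)` has finitely
many roots for every `M`.
-/

/-- The standard Gaussian measure on `ι → ℝ`. -/
noncomputable abbrev gaussianPi (ι : Type*) [Fintype ι] : Measure (ι → ℝ) :=
  Measure.pi fun _ => gaussianReal 0 1

/-- The density of the standard Gaussian measure on `ι → ℝ`. -/
noncomputable def gaussianPiDensity {ι : Type*} [Fintype ι] (z : ι → ℝ) : ℝ :=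
  ∏ i, gaussianPDFReal 0 1 (z i)

/-- `g` grows at most exponentially, with one constant serving both as factor and as rate. This is
the class of functions for which Gaussian integrals are differentiated and integrated by parts. -/
def HasExpGrowth {E : Type*} [Norm E] (g : E → ℝ) : Prop :=
  ∃ C : ℝ, 0 ≤ C ∧ ∀ z, |g z| ≤ C * Real.exp (C * ‖z‖)

section ExpGrowth

variable {E F : Type*} [SeminormedAddCommGroup E] [SeminormedAddCommGroup F]

lemma HasExpGrowth.of_abs_le {g h : E → ℝ} (hh : HasExpGrowth h) (hgh : ∀ z, |g z| ≤ |h z|) :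
    HasExpGrowth g := by
  obtain ⟨C, hC, H⟩ := hh
  exact ⟨C, hC, fun z => (hgh z).trans (H z)⟩

lemma HasExpGrowth.const (a : ℝ) : HasExpGrowth (fun _ : E => a) :=
  ⟨|a|, abs_nonneg a, fun _ => le_mul_of_one_le_right (abs_nonneg a)
    (Real.one_le_exp (by positivity))⟩

lemma HasExpGrowth.add {g h : E → ℝ} (hg : HasExpGrowth g) (hh : HasExpGrowth h) :
    HasExpGrowth (fun z => g z + h z) := by
  obtain ⟨C, hC, H⟩ := hg
  obtain ⟨D, hD, K⟩ := hh
  refine ⟨C + D, by positivity, fun z => (abs_add_le _ _).trans ?_⟩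
  rw [add_mul]
  refine add_le_add ((H z).trans ?_) ((K z).trans ?_)
  · gcongr; linarith
  · gcongr; linarith

lemma HasExpGrowth.mul {g h : E → ℝ} (hg : HasExpGrowth g) (hh : HasExpGrowth h) :
    HasExpGrowth (fun z => g z * h z) := by
  obtain ⟨C, hC, H⟩ := hg
  obtain ⟨D, hD, K⟩ := hh
  refine ⟨C * D + (C + D), by positivity, fun z => ?_⟩
  have hCD : 0 ≤ C * D := by positivity
  calc |g z * h z| ≤ (C * Real.exp (C * ‖z‖)) * (D * Real.exp (D * ‖z‖)) := by
        rw [abs_mul]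
        exact mul_le_mul (H z) (K z) (abs_nonneg _) (by positivity)
    _ = (C * D) * Real.exp ((C + D) * ‖z‖) := by
        rw [add_mul C D, Real.exp_add]; ring
    _ ≤ (C * D + (C + D)) * Real.exp ((C * D + (C + D)) * ‖z‖) := by
        refine mul_le_mul (by linarith) (Real.exp_le_exp.2 ?_) (Real.exp_pos _).le (by positivity)
        exact mul_le_mul_of_nonneg_right (by linarith) (norm_nonneg z)

lemma HasExpGrowth.sum {κ : Type*} {s : Finset κ} {g : κ → E → ℝ}
    (hg : ∀ k ∈ s, HasExpGrowth (g k)) : HasExpGrowth (fun z => ∑ k ∈ s, g k z) := by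
  classical
  induction s using Finset.induction_on with
  | empty => simpa using HasExpGrowth.const (E := E) 0
  | insert k s hk ih =>
    simp only [Finset.sum_insert hk]
    exact (hg k (Finset.mem_insert_self k s)).add
      (ih fun l hl => hg l (Finset.mem_insert_of_mem hl))

lemma HasExpGrowth.pow {g : E → ℝ} (hg : HasExpGrowth g) (k : ℕ) :
    HasExpGrowth (fun z => g z ^ k) := by
  induction k with
  | zero => simpa using HasExpGrowth.const (E := E) 1
  | succ k ih => simpa only [pow_succ] using ih.mul hg

lemma HasExpGrowth.comp_of_norm_le {g : E → ℝ} (hg : HasExpGrowth g) {f : F → E} {K : ℝ}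
    (hf : ∀ z, ‖f z‖ ≤ K * ‖z‖) : HasExpGrowth fun z => g (f z) := by
  obtain ⟨C, hC, H⟩ := hg
  refine ⟨C + C * |K|, by positivity, fun z => (H (f z)).trans ?_⟩
  have hK : C * ‖f z‖ ≤ (C + C * |K|) * ‖z‖ := calc
    C * ‖f z‖ ≤ C * (|K| * ‖z‖) := by
      gcongr
      exact (hf z).trans (by gcongr; exact le_abs_self K)
    _ ≤ (C + C * |K|) * ‖z‖ := by nlinarith [mul_nonneg hC (norm_nonneg z)]
  gcongr
  exact le_add_of_nonneg_right (by positivity)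

lemma hasExpGrowth_norm : HasExpGrowth fun z : E => ‖z‖ := by
  refine ⟨1, zero_le_one, fun z => ?_⟩
  rw [abs_norm, one_mul, one_mul]
  linarith [Real.add_one_le_exp ‖z‖]

lemma hasExpGrowth_exp_mul_norm (C : ℝ) : HasExpGrowth fun z : E => Real.exp (C * ‖z‖) := by
  refine ⟨1 + |C|, by positivity, fun z => ?_⟩
  rw [Real.abs_exp]
  refine le_trans ?_ (le_mul_of_one_le_left (Real.exp_pos _).le (by linarith [abs_nonneg C]))
  gcongr
  linarith [le_abs_self C]

end ExpGrowth

section GaussianPi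

variable {ι κ : Type*} [Fintype ι] [Fintype κ]

lemma integrable_exp_mul_abs_gaussianReal (C : ℝ) :
    Integrable (fun x => Real.exp (C * |x|)) (gaussianReal 0 1) :=
  integrable_exp_mul_abs (integrable_exp_mul_gaussianReal C) (integrable_exp_mul_gaussianReal (-C))

lemma HasExpGrowth.integrable_gaussianPi {g : (ι → ℝ) → ℝ} (hg : HasExpGrowth g)
    (hm : Continuous g) : Integrable g (gaussianPi ι) := by
  obtain ⟨C, hC, H⟩ := hg
  have hi : Integrable (fun z : ι → ℝ => ∏ i, Real.exp (C * |z i|)) (gaussianPi ι) :=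
    Integrable.fintype_prod (f := fun _ x => Real.exp (C * |x|))
      fun _ => integrable_exp_mul_abs_gaussianReal C
  refine (hi.const_mul C).mono' hm.aestronglyMeasurable (Eventually.of_forall fun z => ?_)
  rw [← Real.exp_sum, ← Finset.mul_sum]
  refine (H z).trans ?_
  gcongr
  exact (pi_norm_le_iff_of_nonneg (by positivity)).2 fun i =>
    Finset.single_le_sum (f := fun i => |z i|) (fun _ _ => abs_nonneg _) (Finset.mem_univ i)

lemma integral_comp_inl_mul_comp_inr_gaussianPi (f : (ι → ℝ) → ℝ) (g : (κ → ℝ) → ℝ) :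
    ∫ z, f (z ∘ Sum.inl) * g (z ∘ Sum.inr) ∂gaussianPi (ι ⊕ κ) =
      (∫ x, f x ∂gaussianPi ι) * ∫ y, g y ∂gaussianPi κ := by
  rw [← integral_prod_mul]
  exact (measurePreserving_sumPiEquivProdPi fun _ : ι ⊕ κ => gaussianReal 0 1).integral_comp'
    fun z : (ι → ℝ) × (κ → ℝ) => f z.1 * g z.2

lemma integrable_comp_inl_mul_comp_inr_gaussianPi {f : (ι → ℝ) → ℝ} {g : (κ → ℝ) → ℝ}
    (hf : Integrable f (gaussianPi ι)) (hg : Integrable g (gaussianPi κ)) :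
    Integrable (fun z => f (z ∘ Sum.inl) * g (z ∘ Sum.inr)) (gaussianPi (ι ⊕ κ)) :=
  ((measurePreserving_sumPiEquivProdPi fun _ : ι ⊕ κ => gaussianReal 0 1).integrable_comp_emb
    (MeasurableEquiv.measurableEmbedding _)).2 (hf.mul_prod hg)

lemma integral_comp_inl_gaussianPi (f : (ι → ℝ) → ℝ) :
    ∫ z, f (z ∘ Sum.inl) ∂gaussianPi (ι ⊕ κ) = ∫ x, f x ∂gaussianPi ι := by
  simpa using integral_comp_inl_mul_comp_inr_gaussianPi f fun _ : κ → ℝ => 1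

lemma integral_comp_inr_gaussianPi (g : (κ → ℝ) → ℝ) :
    ∫ z, g (z ∘ Sum.inr) ∂gaussianPi (ι ⊕ κ) = ∫ y, g y ∂gaussianPi κ := by
  simpa using integral_comp_inl_mul_comp_inr_gaussianPi (fun _ : ι → ℝ => 1) g

lemma gaussianPiDensity_nonneg (z : ι → ℝ) : 0 ≤ gaussianPiDensity z :=
  Finset.prod_nonneg fun i _ => gaussianPDFReal_nonneg 0 1 (z i)

lemma measurable_gaussianPiDensity : Measurable (gaussianPiDensity : (ι → ℝ) → ℝ) :=
  Finset.measurable_prod _ fun i _ =>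
    (measurable_gaussianPDFReal 0 1).comp (measurable_pi_apply i)

lemma gaussianPi_eq_withDensity :
    gaussianPi ι = volume.withDensity fun z => ENNReal.ofReal (gaussianPiDensity z) := by
  refine Measure.pi_eq fun s hs => ?_
  rw [withDensity_apply _ (MeasurableSet.univ_pi hs), volume_pi, Measure.restrict_pi_pi,
    ← ofReal_integral_eq_lintegral_ofReal]
  · unfold gaussianPiDensity
    rw [integral_fintype_prod_eq_prod (f := fun _ x => gaussianPDFReal 0 1 x),
      ENNReal.ofReal_prod_of_nonneg
        (fun i _ => integral_nonneg fun x => gaussianPDFReal_nonneg 0 1 x)]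
    exact Finset.prod_congr rfl fun i _ =>
      (gaussianReal_apply_eq_integral 0 one_ne_zero (s i)).symm
  · exact Integrable.fintype_prod (f := fun _ x => gaussianPDFReal 0 1 x)
      fun i => (integrable_gaussianPDFReal 0 1).restrict
  · exact Eventually.of_forall gaussianPiDensity_nonneg

lemma integrable_gaussianPi_iff {g : (ι → ℝ) → ℝ} :
    Integrable g (gaussianPi ι) ↔ Integrable fun z => gaussianPiDensity z * g z := by
  rw [gaussianPi_eq_withDensity, integrable_withDensity_iff_integrable_smul'
    measurable_gaussianPiDensity.ennreal_ofReal (by simp)]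
  simp [ENNReal.toReal_ofReal, gaussianPiDensity_nonneg]

lemma integral_gaussianPi {g : (ι → ℝ) → ℝ} :
    ∫ z, g z ∂gaussianPi ι = ∫ z, gaussianPiDensity z * g z := by
  rw [gaussianPi_eq_withDensity, integral_withDensity_eq_integral_toReal_smul
    measurable_gaussianPiDensity.ennreal_ofReal (by simp)]
  simp [ENNReal.toReal_ofReal, gaussianPiDensity_nonneg]

lemma gaussianPiDensity_eq_mul_exp (z : ι → ℝ) :
    gaussianPiDensity z = (∏ _i : ι, (√(2 * Real.pi))⁻¹) * Real.exp (-(z ⬝ᵥ z) / 2) := by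
  simp only [gaussianPiDensity, gaussianPDFReal, Finset.prod_mul_distrib, ← Real.exp_sum]
  simp [dotProduct, ← Finset.sum_neg_distrib, Finset.sum_div, sq]

lemma hasLineDerivAt_dotProduct_self (z v : ι → ℝ) :
    HasLineDerivAt ℝ (fun z => z ⬝ᵥ z) (2 * (v ⬝ᵥ z)) z v := by
  have h (i : ι) : HasDerivAt (fun t : ℝ => (z i + t * v i) * (z i + t * v i))
      (2 * (v i * z i)) 0 := by
    have h1 : HasDerivAt (fun t : ℝ => z i + t * v i) (v i) 0 := by
      simpa using ((hasDerivAt_id (0 : ℝ)).mul_const (v i)).const_add (z i)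
    exact (h1.fun_mul h1).congr_deriv (by ring)
  rw [dotProduct, Finset.mul_sum]
  exact HasDerivAt.fun_sum fun i _ => h i

lemma hasLineDerivAt_gaussianPiDensity (z v : ι → ℝ) :
    HasLineDerivAt ℝ gaussianPiDensity (-((v ⬝ᵥ z) * gaussianPiDensity z)) z v := by
  have h := ((hasLineDerivAt_dotProduct_self z v).fun_neg.div_const 2).exp.const_mul
    (∏ _i : ι, (√(2 * Real.pi))⁻¹)
  simp only [zero_smul, add_zero] at h
  refine (h.congr_deriv ?_).congr_of_eventuallyEq
    (Eventually.of_forall fun t => gaussianPiDensity_eq_mul_exp _)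
  rw [gaussianPiDensity_eq_mul_exp]
  ring

theorem gaussianPi_stein_identity {g g' : (ι → ℝ) → ℝ} {v : ι → ℝ}
    (hg : ∀ z, HasLineDerivAt ℝ g (g' z) z v) (hgi : Integrable g (gaussianPi ι))
    (hgi' : Integrable g' (gaussianPi ι))
    (hvg : Integrable (fun z => (v ⬝ᵥ z) * g z) (gaussianPi ι)) :
    ∫ z, (v ⬝ᵥ z) * g z ∂gaussianPi ι = ∫ z, g' z ∂gaussianPi ι := by
  rw [integrable_gaussianPi_iff] at hgi hgi' hvg
  have key := integral_bilinear_hasLineDerivAt_right_eq_neg_left_of_integrable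
    (μ := (volume : Measure (ι → ℝ))) (B := ContinuousLinearMap.mul ℝ ℝ) (v := v)
    (f := gaussianPiDensity) (f' := fun z => -((v ⬝ᵥ z) * gaussianPiDensity z))
    (g := g) (g' := g') ?_ hgi' hgi
    (fun z _ => hasLineDerivAt_gaussianPiDensity z v) (fun z _ => hg z)
  · simp only [ContinuousLinearMap.mul_apply'] at key
    rw [integral_gaussianPi, integral_gaussianPi, key, ← integral_neg]
    congr 1 with z
    ring
  · convert hvg.neg using 2
    simp only [ContinuousLinearMap.mul_apply', Pi.neg_apply]
    ring

end GaussianPi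

/-- `F' τ` are the first and `F'' τ σ` the second partial derivatives of `F`, the latter are
continuous, and all of them grow at most exponentially: the regularity under which Gaussian
interpolation of `F` is legitimate. -/
structure HasPartialsWithExpGrowth {T : Type*} [Fintype T] (F : (T → ℝ) → ℝ)
    (F' : T → (T → ℝ) → ℝ) (F'' : T → T → (T → ℝ) → ℝ) : Prop where
  hasFDerivAt : ∀ x, HasFDerivAt F (∑ τ, F' τ x • ContinuousLinearMap.proj (R := ℝ) τ) x
  hasFDerivAt_partial : ∀ τ x,
    HasFDerivAt (F' τ) (∑ σ, F'' τ σ x • ContinuousLinearMap.proj (R := ℝ) σ) x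
  continuous_second : ∀ τ σ, Continuous (F'' τ σ)
  growth : HasExpGrowth F
  growth_partial : ∀ τ, HasExpGrowth (F' τ)
  growth_second : ∀ τ σ, HasExpGrowth (F'' τ σ)

/-- The matrix `[cos θ A | sin θ B]`: applied to a standard Gaussian vector it interpolates between
the centred Gaussian vectors with covariances `A Aᵀ` (at `θ = 0`) and `B Bᵀ` (at `θ = π / 2`). -/
noncomputable def gaussianRotation {T ι κ : Type*} (A : Matrix T ι ℝ) (B : Matrix T κ ℝ) (θ : ℝ) :
    Matrix T (ι ⊕ κ) ℝ :=
  Matrix.fromCols (Real.cos θ • A) (Real.sin θ • B)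

section Kahane

variable {ι κ T : Type*} [Fintype ι] [Fintype κ]

lemma continuous_mulVec (M : Matrix T ι ℝ) : Continuous fun z => M *ᵥ z :=
  M.mulVecLin.continuous_of_finiteDimensional

lemma gaussianRotation_mulVec (A : Matrix T ι ℝ) (B : Matrix T κ ℝ) (θ : ℝ) (z : ι ⊕ κ → ℝ) :
    gaussianRotation A B θ *ᵥ z =
      Real.cos θ • A *ᵥ (z ∘ Sum.inl) + Real.sin θ • B *ᵥ (z ∘ Sum.inr) := by
  rw [gaussianRotation, Matrix.fromCols_mulVec, Matrix.smul_mulVec, Matrix.smul_mulVec]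

lemma gaussianRotation_zero_mulVec (A : Matrix T ι ℝ) (B : Matrix T κ ℝ) (z : ι ⊕ κ → ℝ) :
    gaussianRotation A B 0 *ᵥ z = A *ᵥ (z ∘ Sum.inl) := by
  simp [gaussianRotation_mulVec]

lemma gaussianRotation_pi_div_two_mulVec (A : Matrix T ι ℝ) (B : Matrix T κ ℝ) (z : ι ⊕ κ → ℝ) :
    gaussianRotation A B (Real.pi / 2) *ᵥ z = B *ᵥ (z ∘ Sum.inr) := by
  simp [gaussianRotation_mulVec]

lemma gaussianRotation_mul_transpose_add_pi_div_two (A : Matrix T ι ℝ)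
    (B : Matrix T κ ℝ) (θ : ℝ) :
    gaussianRotation A B θ * (gaussianRotation A B (θ + Real.pi / 2))ᵀ =
      (Real.sin θ * Real.cos θ) • (B * Bᵀ - A * Aᵀ) := by
  rw [gaussianRotation, gaussianRotation, Matrix.transpose_fromCols, Matrix.fromCols_mul_fromRows,
    Real.cos_add_pi_div_two, Real.sin_add_pi_div_two]
  simp only [Matrix.transpose_smul, Matrix.smul_mul, Matrix.mul_smul, smul_smul]
  module

lemma hasDerivAt_gaussianRotation_mulVec [Finite T] (A : Matrix T ι ℝ) (B : Matrix T κ ℝ)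
    (θ : ℝ) (z : ι ⊕ κ → ℝ) : HasDerivAt (fun θ => gaussianRotation A B θ *ᵥ z)
      (gaussianRotation A B (θ + Real.pi / 2) *ᵥ z) θ := by
  have := Fintype.ofFinite T
  simp only [gaussianRotation_mulVec, Real.cos_add_pi_div_two, Real.sin_add_pi_div_two]
  exact ((Real.hasDerivAt_cos θ).smul_const _).add ((Real.hasDerivAt_sin θ).smul_const _)

variable [Fintype T] {F : (T → ℝ) → ℝ} {F' : T → (T → ℝ) → ℝ} {F'' : T → T → (T → ℝ) → ℝ}

lemma exists_forall_norm_mulVec_le (M : Matrix T ι ℝ) : ∃ K, ∀ z, ‖M *ᵥ z‖ ≤ K * ‖z‖ :=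
  ⟨_, M.mulVecLin.toContinuousLinearMap.le_opNorm⟩

lemma HasExpGrowth.comp_mulVec {g : (T → ℝ) → ℝ} (hg : HasExpGrowth g) (M : Matrix T ι ℝ) :
    HasExpGrowth fun z => g (M *ᵥ z) :=
  let ⟨_, hK⟩ := exists_forall_norm_mulVec_le M
  hg.comp_of_norm_le hK

lemma hasExpGrowth_eval (τ : T) : HasExpGrowth fun z : T → ℝ => z τ :=
  hasExpGrowth_norm.of_abs_le fun z => by
    rw [abs_norm]
    exact norm_le_pi_norm z τ

lemma hasLineDerivAt_comp_mulVec {f : (T → ℝ) → ℝ} {f' : T → ℝ} (M : Matrix T ι ℝ)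
    {v z : ι → ℝ}
    (hf : HasFDerivAt f (∑ σ, f' σ • ContinuousLinearMap.proj (R := ℝ) (φ := fun _ => ℝ) σ)
      (M *ᵥ z)) :
    HasLineDerivAt ℝ (fun z => f (M *ᵥ z)) (∑ σ, f' σ * (M *ᵥ v) σ) z v := by
  have h := hf.comp z M.mulVecLin.toContinuousLinearMap.hasFDerivAt
  refine HasDerivAt.congr_deriv (h.hasLineDerivAt v) ?_
  simp

namespace HasPartialsWithExpGrowth

lemma continuous (h : HasPartialsWithExpGrowth F F' F'') : Continuous F :=
  continuous_iff_continuousAt.2 fun x => (h.hasFDerivAt x).continuousAt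

lemma continuous_partial (h : HasPartialsWithExpGrowth F F' F'') (τ : T) : Continuous (F' τ) :=
  continuous_iff_continuousAt.2 fun x => (h.hasFDerivAt_partial τ x).continuousAt

lemma integrable_comp_mulVec (h : HasPartialsWithExpGrowth F F' F'') (M : Matrix T ι ℝ) :
    Integrable (fun z => F (M *ᵥ z)) (gaussianPi ι) :=
  (h.growth.comp_mulVec M).integrable_gaussianPi (h.continuous.comp (continuous_mulVec M))

lemma integral_sum_partial_mul_mulVec (h : HasPartialsWithExpGrowth F F' F'')
    (M N : Matrix T ι ℝ) :
    ∫ z, ∑ τ, F' τ (M *ᵥ z) * (N *ᵥ z) τ ∂gaussianPi ι =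
      ∫ z, ∑ τ, ∑ σ, F'' τ σ (M *ᵥ z) * (M * Nᵀ) σ τ ∂gaussianPi ι := by
  have hF' (τ : T) : Continuous fun z => F' τ (M *ᵥ z) :=
    (h.continuous_partial τ).comp (continuous_mulVec M)
  have hN (τ : T) : Continuous fun z => (N *ᵥ z) τ :=
    (continuous_apply τ).comp (continuous_mulVec N)
  have hi (τ : T) : Integrable (fun z => (N *ᵥ z) τ * F' τ (M *ᵥ z)) (gaussianPi ι) :=
    (((hasExpGrowth_eval τ).comp_mulVec N).mul
      ((h.growth_partial τ).comp_mulVec M)).integrable_gaussianPi ((hN τ).mul (hF' τ))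
  have hi' (τ : T) : Integrable (fun z => ∑ σ, F'' τ σ (M *ᵥ z) * (M * Nᵀ) σ τ) (gaussianPi ι) :=
    (HasExpGrowth.sum fun σ _ => ((h.growth_second τ σ).comp_mulVec M).mul
      (.const _)).integrable_gaussianPi (continuous_finsetSum _ fun σ _ =>
        ((h.continuous_second τ σ).comp (continuous_mulVec M)).mul continuous_const)
  simp only [mul_comm (F' _ _)]
  rw [integral_finsetSum _ fun τ _ => hi τ, integral_finsetSum _ fun τ _ => hi' τ]
  exact Finset.sum_congr rfl fun τ _ => gaussianPi_stein_identity
    (fun z => hasLineDerivAt_comp_mulVec M (h.hasFDerivAt_partial τ (M *ᵥ z)))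
    (((h.growth_partial τ).comp_mulVec M).integrable_gaussianPi (hF' τ)) (hi' τ) (hi τ)

end HasPartialsWithExpGrowth

lemma exists_forall_norm_gaussianRotation_mulVec_le (A : Matrix T ι ℝ) (B : Matrix T κ ℝ) :
    ∃ K, 0 ≤ K ∧ ∀ θ z, ‖gaussianRotation A B θ *ᵥ z‖ ≤ K * ‖z‖ := by
  obtain ⟨K, hK⟩ := exists_forall_norm_mulVec_le (Matrix.fromCols A (0 : Matrix T κ ℝ))
  obtain ⟨L, hL⟩ := exists_forall_norm_mulVec_le (Matrix.fromCols (0 : Matrix T ι ℝ) B)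
  refine ⟨|K| + |L|, by positivity, fun θ z => ?_⟩
  have hA := (hK z).trans (mul_le_mul_of_nonneg_right (le_abs_self K) (norm_nonneg z))
  have hB := (hL z).trans (mul_le_mul_of_nonneg_right (le_abs_self L) (norm_nonneg z))
  rw [Matrix.fromCols_mulVec, Matrix.zero_mulVec] at hA hB
  rw [add_zero] at hA
  rw [zero_add] at hB
  rw [gaussianRotation_mulVec, add_mul]
  refine norm_add_le_of_le ?_ ?_ <;> rw [norm_smul]
  · exact (mul_le_of_le_one_left (norm_nonneg _) (Real.abs_cos_le_one θ)).trans hA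
  · exact (mul_le_of_le_one_left (norm_nonneg _) (Real.abs_sin_le_one θ)).trans hB

namespace HasPartialsWithExpGrowth

lemma hasDerivAt_comp_rotation (h : HasPartialsWithExpGrowth F F' F'') (A : Matrix T ι ℝ)
    (B : Matrix T κ ℝ) (θ : ℝ) (z : ι ⊕ κ → ℝ) :
    HasDerivAt (fun θ => F (gaussianRotation A B θ *ᵥ z))
      (∑ τ, F' τ (gaussianRotation A B θ *ᵥ z) *
        (gaussianRotation A B (θ + Real.pi / 2) *ᵥ z) τ) θ := by
  refine ((h.hasFDerivAt _).comp_hasDerivAt θ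
    (hasDerivAt_gaussianRotation_mulVec A B θ z)).congr_deriv ?_
  simp

lemma hasDerivAt_integral_comp_rotation (h : HasPartialsWithExpGrowth F F' F'')
    (A : Matrix T ι ℝ) (B : Matrix T κ ℝ) (θ : ℝ) :
    HasDerivAt (fun θ => ∫ z, F (gaussianRotation A B θ *ᵥ z) ∂gaussianPi (ι ⊕ κ))
      (∫ z, ∑ τ, F' τ (gaussianRotation A B θ *ᵥ z) *
        (gaussianRotation A B (θ + Real.pi / 2) *ᵥ z) τ ∂gaussianPi (ι ⊕ κ)) θ := by
  obtain ⟨K, _, hrot⟩ := exists_forall_norm_gaussianRotation_mulVec_le A B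
  choose C hC hF' using h.growth_partial
  let bound (z : ι ⊕ κ → ℝ) : ℝ := ∑ τ, C τ * Real.exp (C τ * K * ‖z‖) * (K * ‖z‖)
  have hbound : Integrable bound (gaussianPi (ι ⊕ κ)) :=
    (HasExpGrowth.sum fun τ _ => ((HasExpGrowth.const _).mul (hasExpGrowth_exp_mul_norm _)).mul
      ((HasExpGrowth.const K).mul hasExpGrowth_norm)).integrable_gaussianPi (by fun_prop)
  have hle (z : ι ⊕ κ → ℝ) (θ : ℝ) : ‖∑ τ, F' τ (gaussianRotation A B θ *ᵥ z) *
      (gaussianRotation A B (θ + Real.pi / 2) *ᵥ z) τ‖ ≤ bound z :=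
    norm_sum_le_of_le _ fun τ _ => by
      rw [norm_mul]
      gcongr
      · have := hC τ
        positivity
      · refine (hF' τ _).trans ?_
        have := hC τ
        rw [mul_assoc (C τ) K]
        gcongr
        exact hrot θ z
      · exact (norm_le_pi_norm _ τ).trans (hrot _ z)
  have hmeas : Continuous fun z => ∑ τ, F' τ (gaussianRotation A B θ *ᵥ z) *
      (gaussianRotation A B (θ + Real.pi / 2) *ᵥ z) τ :=
    continuous_finsetSum _ fun τ _ => ((h.continuous_partial τ).comp (continuous_mulVec _)).mul
      ((continuous_apply τ).comp (continuous_mulVec _))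
  exact (hasDerivAt_integral_of_dominated_loc_of_deriv_le univ_mem
    (.of_forall fun θ => (h.integrable_comp_mulVec (gaussianRotation A B θ)).aestronglyMeasurable)
    (h.integrable_comp_mulVec (gaussianRotation A B θ)) hmeas.aestronglyMeasurable
    (.of_forall fun z θ _ => hle z θ) hbound
    (.of_forall fun z θ _ => h.hasDerivAt_comp_rotation A B θ z)).2

theorem kahane_integral_comp_mulVec_le (h : HasPartialsWithExpGrowth F F' F'')
    (A : Matrix T ι ℝ) (B : Matrix T κ ℝ)
    (hAB : ∀ τ σ x, 0 ≤ F'' τ σ x * (B * Bᵀ - A * Aᵀ) σ τ) :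
    ∫ x, F (A *ᵥ x) ∂gaussianPi ι ≤ ∫ y, F (B *ᵥ y) ∂gaussianPi κ := by
  have hderiv := h.hasDerivAt_integral_comp_rotation A B
  have hmono : MonotoneOn (fun θ => ∫ z, F (gaussianRotation A B θ *ᵥ z) ∂gaussianPi (ι ⊕ κ))
      (Set.Icc 0 (Real.pi / 2)) := by
    refine monotoneOn_of_deriv_nonneg (convex_Icc _ _)
      (fun θ _ => (hderiv θ).continuousAt.continuousWithinAt)
      (fun θ _ => (hderiv θ).differentiableAt.differentiableWithinAt) fun θ hθ => ?_
    rw [interior_Icc] at hθ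
    have hsc : 0 ≤ Real.sin θ * Real.cos θ := mul_nonneg
      (Real.sin_nonneg_of_nonneg_of_le_pi hθ.1.le (by linarith [hθ.2, Real.pi_pos]))
      (Real.cos_nonneg_of_neg_pi_div_two_le_of_le (by linarith [hθ.1, Real.pi_pos]) hθ.2.le)
    rw [(hderiv θ).deriv, h.integral_sum_partial_mul_mulVec,
      gaussianRotation_mul_transpose_add_pi_div_two]
    refine integral_nonneg fun z => Finset.sum_nonneg fun τ _ => Finset.sum_nonneg fun σ _ => ?_
    rw [Matrix.smul_apply, smul_eq_mul, mul_left_comm]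
    exact mul_nonneg hsc (hAB τ σ _)
  have hends := hmono (Set.left_mem_Icc.2 (by positivity)) (Set.right_mem_Icc.2 (by positivity))
    (by positivity)
  simp only [gaussianRotation_zero_mulVec, gaussianRotation_pi_div_two_mulVec] at hends
  rwa [integral_comp_inl_gaussianPi fun x => F (A *ᵥ x),
    integral_comp_inr_gaussianPi fun y => F (B *ᵥ y)] at hends

end HasPartialsWithExpGrowth

end Kahane

/-- The sum `∑ τ, exp (x τ)`. For large `β`, `sumExp (β • x) ^ β⁻¹` is a smooth substitute for
`exp (⨆ τ, x τ)`. -/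
noncomputable def sumExp {T : Type*} [Fintype T] (x : T → ℝ) : ℝ := ∑ τ, Real.exp (x τ)

section Slepian

variable {ι κ T : Type*} [Fintype ι] [Fintype κ] [Fintype T]

lemma exp_le_sumExp (x : T → ℝ) (τ : T) : Real.exp (x τ) ≤ sumExp x :=
  Finset.single_le_sum (f := fun τ => Real.exp (x τ)) (fun _ _ => (Real.exp_pos _).le)
    (Finset.mem_univ τ)

lemma sumExp_pos [Nonempty T] (x : T → ℝ) : 0 < sumExp x :=
  Finset.sum_pos (fun _ _ => Real.exp_pos _) Finset.univ_nonempty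

lemma continuous_sumExp_rpow [Nonempty T] (q : ℝ) : Continuous fun x : T → ℝ => sumExp x ^ q :=
  Continuous.rpow_const (by unfold sumExp; fun_prop) fun x => Or.inl (sumExp_pos x).ne'

lemma hasFDerivAt_sumExp_rpow [Nonempty T] (q : ℝ) (x : T → ℝ) :
    HasFDerivAt (fun x : T → ℝ => sumExp x ^ q)
      (∑ τ, (q * (Real.exp (x τ) * sumExp x ^ (q - 1))) •
        ContinuousLinearMap.proj (R := ℝ) (φ := fun _ => ℝ) τ) x := by
  have hS : HasFDerivAt sumExp
      (∑ τ, Real.exp (x τ) • ContinuousLinearMap.proj (R := ℝ) (φ := fun _ => ℝ) τ) x :=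
    HasFDerivAt.fun_sum fun τ _ => (hasFDerivAt_apply τ x).exp
  refine (hS.rpow_const (p := q) (Or.inl (sumExp_pos x).ne')).congr_fderiv ?_
  rw [Finset.smul_sum]
  exact Finset.sum_congr rfl fun τ _ => by rw [smul_smul]; ring_nf

lemma hasFDerivAt_exp_mul_sumExp_rpow [Nonempty T] [DecidableEq T] (q : ℝ) (τ : T) (x : T → ℝ) :
    HasFDerivAt (fun x : T → ℝ => Real.exp (x τ) * sumExp x ^ q)
      (∑ σ, ((if τ = σ then Real.exp (x τ) * sumExp x ^ q else 0) +
        q * (Real.exp (x τ) * Real.exp (x σ) * sumExp x ^ (q - 1))) •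
          ContinuousLinearMap.proj (R := ℝ) (φ := fun _ => ℝ) σ) x := by
  refine (((hasFDerivAt_apply τ x).exp).fun_mul (hasFDerivAt_sumExp_rpow q x)).congr_fderiv ?_
  simp only [add_smul, Finset.sum_add_distrib, ite_smul, zero_smul, Finset.sum_ite_eq,
    Finset.mem_univ, if_true, Finset.smul_sum, smul_smul]
  rw [add_comm, mul_comm (sumExp x ^ q)]
  congr 1
  exact Finset.sum_congr rfl fun σ _ => by ring_nf

lemma rpow_le_one_add {x p : ℝ} (hx : 0 ≤ x) (hp0 : 0 ≤ p) (hp1 : p ≤ 1) : x ^ p ≤ 1 + x := by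
  rcases le_total x 1 with h | h
  · linarith [Real.rpow_le_one hx h hp0]
  · linarith [(Real.rpow_le_rpow_of_exponent_le h hp1).trans_eq (Real.rpow_one x)]

lemma hasExpGrowth_exp_apply (τ : T) : HasExpGrowth fun x : T → ℝ => Real.exp (x τ) :=
  (hasExpGrowth_exp_mul_norm 1).of_abs_le fun x => by
    rw [Real.abs_exp, Real.abs_exp, one_mul, Real.exp_le_exp]
    exact (le_abs_self _).trans (norm_le_pi_norm x τ)

lemma hasExpGrowth_sumExp_rpow [Nonempty T] {p : ℝ} (hp0 : 0 ≤ p) (hp1 : p ≤ 1) :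
    HasExpGrowth fun x : T → ℝ => sumExp x ^ p :=
  ((HasExpGrowth.const 1).add
    (HasExpGrowth.sum fun τ _ => hasExpGrowth_exp_apply τ)).of_abs_le fun x => by
      rw [abs_of_nonneg (Real.rpow_nonneg (sumExp_pos x).le p)]
      exact (rpow_le_one_add (sumExp_pos x).le hp0 hp1).trans (le_abs_self _)

lemma HasExpGrowth.exp_apply_mul_sumExp_rpow_sub_one [Nonempty T] {g : (T → ℝ) → ℝ} {q : ℝ}
    (hg : HasExpGrowth fun x => g x * sumExp x ^ q) (τ : T) :
    HasExpGrowth fun x => g x * Real.exp (x τ) * sumExp x ^ (q - 1) :=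
  hg.of_abs_le fun x => by
    have hS := sumExp_pos x
    have h : Real.exp (x τ) * sumExp x ^ (q - 1) ≤ sumExp x ^ q := calc
      _ ≤ sumExp x * sumExp x ^ (q - 1) := by gcongr; exact exp_le_sumExp x τ
      _ = sumExp x ^ q := by rw [Real.rpow_sub_one hS.ne', mul_div_cancel₀ _ hS.ne']
    rw [mul_assoc, abs_mul, abs_mul (g x) (sumExp x ^ q)]
    gcongr

lemma hasPartialsWithExpGrowth_sumExp_rpow [Nonempty T] [DecidableEq T] {p : ℝ} (hp0 : 0 ≤ p)
    (hp1 : p ≤ 1) : HasPartialsWithExpGrowth (fun x : T → ℝ => sumExp x ^ p)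
      (fun τ x => p * (Real.exp (x τ) * sumExp x ^ (p - 1)))
      (fun τ σ x => p * ((if τ = σ then Real.exp (x τ) * sumExp x ^ (p - 1) else 0) +
        (p - 1) * (Real.exp (x τ) * Real.exp (x σ) * sumExp x ^ (p - 1 - 1)))) := by
  have hgrowth := hasExpGrowth_sumExp_rpow (T := T) hp0 hp1
  have hgrowth₁ (τ : T) : HasExpGrowth fun x : T → ℝ => Real.exp (x τ) * sumExp x ^ (p - 1) := by
    simpa only [one_mul] using HasExpGrowth.exp_apply_mul_sumExp_rpow_sub_one (g := fun _ => 1)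
      (by simpa only [one_mul] using hgrowth) τ
  have hcont := continuous_sumExp_rpow (T := T)
  refine ⟨hasFDerivAt_sumExp_rpow p, fun τ x => ?_, fun τ σ => ?_, hgrowth,
    fun τ => (HasExpGrowth.const p).mul (hgrowth₁ τ), fun τ σ => (HasExpGrowth.const p).mul
      (.add ?_ ((HasExpGrowth.const _).mul ((hgrowth₁ τ).exp_apply_mul_sumExp_rpow_sub_one σ)))⟩
  · refine ((hasFDerivAt_exp_mul_sumExp_rpow (p - 1) τ x).const_mul p).congr_fderiv ?_
    rw [Finset.smul_sum]
    exact Finset.sum_congr rfl fun σ _ => smul_smul _ _ _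
  · have := hcont (p - 1)
    have := hcont (p - 1 - 1)
    split_ifs <;> fun_prop
  · split_ifs
    · exact hgrowth₁ τ
    · exact .const 0

lemma integral_sumExp_mulVec_rpow_le [Nonempty T] {p : ℝ} (hp0 : 0 ≤ p) (hp1 : p ≤ 1)
    {A : Matrix T ι ℝ} {B : Matrix T κ ℝ} (hdiag : ∀ τ, (A * Aᵀ) τ τ = (B * Bᵀ) τ τ)
    (hoff : ∀ τ σ, (B * Bᵀ) τ σ ≤ (A * Aᵀ) τ σ) :
    ∫ x, sumExp (A *ᵥ x) ^ p ∂gaussianPi ι ≤ ∫ y, sumExp (B *ᵥ y) ^ p ∂gaussianPi κ := by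
  classical
  refine (hasPartialsWithExpGrowth_sumExp_rpow hp0 hp1).kahane_integral_comp_mulVec_le A B
    fun τ σ x => ?_
  have hS := sumExp_pos x
  by_cases h : τ = σ
  · subst h
    simp [hdiag]
  · rw [if_neg h, zero_add, Matrix.sub_apply]
    refine mul_nonneg_of_nonpos_of_nonpos ?_ (sub_nonpos.2 (hoff σ τ))
    exact mul_nonpos_of_nonneg_of_nonpos hp0
      (mul_nonpos_of_nonpos_of_nonneg (sub_nonpos.2 hp1) (by positivity))

lemma exp_mul_iSup_le_sumExp_rpow [Nonempty T] {l β : ℝ} (hl : 0 ≤ l) (hβ : 0 < β) (x : T → ℝ) :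
    Real.exp (l * ⨆ τ, x τ) ≤ sumExp (β • x) ^ (l / β) := by
  obtain ⟨τ, hτ⟩ := exists_eq_ciSup_of_finite (f := x)
  calc Real.exp (l * ⨆ τ, x τ) = Real.exp (β * x τ) ^ (l / β) := by
        rw [← hτ, ← Real.exp_mul]
        congr 1
        field_simp
    _ ≤ sumExp (β • x) ^ (l / β) := by
        gcongr
        exact exp_le_sumExp (β • x) τ

lemma sumExp_rpow_le_card_rpow_mul_exp_mul_iSup {l β : ℝ} (hl : 0 ≤ l) (hβ : 0 < β) (x : T → ℝ) :
    sumExp (β • x) ^ (l / β) ≤ (Fintype.card T : ℝ) ^ (l / β) * Real.exp (l * ⨆ τ, x τ) := by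
  have hsum : sumExp (β • x) ≤ Fintype.card T * Real.exp (β * ⨆ τ, x τ) := by
    rw [← nsmul_eq_mul]
    refine Finset.sum_le_card_nsmul _ _ _ fun τ _ => Real.exp_le_exp.2 ?_
    exact mul_le_mul_of_nonneg_left (le_ciSup (Set.finite_range x).bddAbove τ) hβ.le
  calc sumExp (β • x) ^ (l / β)
      ≤ (Fintype.card T * Real.exp (β * ⨆ τ, x τ)) ^ (l / β) := by
        gcongr
        exact Finset.sum_nonneg fun _ _ => (Real.exp_pos _).le
    _ = _ := by
        rw [Real.mul_rpow (by positivity) (Real.exp_pos _).le, ← Real.exp_mul]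
        congr 2
        field_simp

lemma continuous_iSup_apply {T : Type*} [Finite T] [Nonempty T] :
    Continuous fun x : T → ℝ => ⨆ τ, x τ := by
  have := Fintype.ofFinite T
  simp only [← Finset.sup'_univ_eq_ciSup]
  exact Continuous.finset_sup'_apply _ fun τ _ => continuous_apply τ

lemma hasExpGrowth_exp_mul_iSup [Nonempty T] (l : ℝ) :
    HasExpGrowth fun x : T → ℝ => Real.exp (l * ⨆ τ, x τ) :=
  (hasExpGrowth_exp_mul_norm |l|).of_abs_le fun x => by
    rw [Real.abs_exp, Real.abs_exp, Real.exp_le_exp]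
    refine (le_abs_self _).trans ?_
    rw [abs_mul]
    gcongr
    obtain ⟨τ, hτ⟩ := exists_eq_ciSup_of_finite (f := x)
    exact hτ ▸ norm_le_pi_norm x τ

lemma integrable_exp_mul_iSup_mulVec {T : Type*} [Finite T] [Nonempty T] (l : ℝ)
    (A : Matrix T ι ℝ) :
    Integrable (fun x => Real.exp (l * ⨆ τ, (A *ᵥ x) τ)) (gaussianPi ι) := by
  have := Fintype.ofFinite T
  exact ((hasExpGrowth_exp_mul_iSup l).comp_mulVec A).integrable_gaussianPi <|
    Real.continuous_exp.comp
      (continuous_const.mul (continuous_iSup_apply.comp (continuous_mulVec A)))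

lemma integrable_sumExp_mulVec_rpow [Nonempty T] {p : ℝ} (hp0 : 0 ≤ p) (hp1 : p ≤ 1)
    (M : Matrix T ι ℝ) : Integrable (fun x => sumExp (M *ᵥ x) ^ p) (gaussianPi ι) :=
  ((hasExpGrowth_sumExp_rpow hp0 hp1).comp_mulVec M).integrable_gaussianPi
    ((continuous_sumExp_rpow p).comp (continuous_mulVec M))

lemma integral_exp_mul_iSup_mulVec_le_card_rpow_mul [Nonempty T] {A : Matrix T ι ℝ}
    {B : Matrix T κ ℝ} (hdiag : ∀ τ, (A * Aᵀ) τ τ = (B * Bᵀ) τ τ)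
    (hoff : ∀ τ σ, (B * Bᵀ) τ σ ≤ (A * Aᵀ) τ σ) {l β : ℝ} (hl : 0 < l) (hβ : l ≤ β) :
    ∫ x, Real.exp (l * ⨆ τ, (A *ᵥ x) τ) ∂gaussianPi ι ≤
      (Fintype.card T : ℝ) ^ (l / β) * ∫ y, Real.exp (l * ⨆ τ, (B *ᵥ y) τ) ∂gaussianPi κ := by
  have hβ0 : 0 < β := hl.trans_le hβ
  have hp0 : 0 ≤ l / β := by positivity
  have hp1 : l / β ≤ 1 := (div_le_one hβ0).2 hβ
  calc _ ≤ ∫ x, sumExp ((β • A) *ᵥ x) ^ (l / β) ∂gaussianPi ι := by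
        refine integral_mono (integrable_exp_mul_iSup_mulVec l A)
          (integrable_sumExp_mulVec_rpow hp0 hp1 _) fun x => ?_
        simpa only [Matrix.smul_mulVec] using exp_mul_iSup_le_sumExp_rpow hl.le hβ0 (A *ᵥ x)
    _ ≤ ∫ y, sumExp ((β • B) *ᵥ y) ^ (l / β) ∂gaussianPi κ := by
        refine integral_sumExp_mulVec_rpow_le hp0 hp1 (fun τ => ?_) fun τ σ => ?_ <;>
          simp only [Matrix.transpose_smul, Matrix.smul_mul, Matrix.mul_smul, Matrix.smul_apply,
            smul_eq_mul]
        · rw [hdiag]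
        · gcongr
          exact hoff τ σ
    _ ≤ ∫ y, (Fintype.card T : ℝ) ^ (l / β) * Real.exp (l * ⨆ τ, (B *ᵥ y) τ) ∂gaussianPi κ := by
        refine integral_mono (integrable_sumExp_mulVec_rpow hp0 hp1 _)
          ((integrable_exp_mul_iSup_mulVec l B).const_mul _) fun y => ?_
        simpa only [Matrix.smul_mulVec] using
          sumExp_rpow_le_card_rpow_mul_exp_mul_iSup hl.le hβ0 (B *ᵥ y)
    _ = _ := integral_const_mul _ _

theorem slepian_integral_exp_mul_iSup_mulVec_le {T : Type*} [Finite T] [Nonempty T]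
    {A : Matrix T ι ℝ} {B : Matrix T κ ℝ} (hdiag : ∀ τ, (A * Aᵀ) τ τ = (B * Bᵀ) τ τ)
    (hoff : ∀ τ σ, (B * Bᵀ) τ σ ≤ (A * Aᵀ) τ σ) {l : ℝ} (hl : 0 < l) :
    ∫ x, Real.exp (l * ⨆ τ, (A *ᵥ x) τ) ∂gaussianPi ι ≤
      ∫ y, Real.exp (l * ⨆ τ, (B *ᵥ y) τ) ∂gaussianPi κ := by
  have := Fintype.ofFinite T
  have hcard : Tendsto (fun β : ℝ => (Fintype.card T : ℝ) ^ (l / β)) atTop (nhds 1) := by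
    have h0 : (Fintype.card T : ℝ) ≠ 0 := by simp
    simpa only [Function.comp_def, id_eq, Real.rpow_zero] using
      (Real.continuousAt_const_rpow (b := 0) h0).tendsto.comp
        (tendsto_const_nhds.div_atTop tendsto_id)
  simpa only [one_mul] using ge_of_tendsto (hcard.mul_const _) (eventually_atTop.2
    ⟨l, fun β hβ => integral_exp_mul_iSup_mulVec_le_card_rpow_mul hdiag hoff hl hβ⟩)

end Slepian

section Chevet

variable {ι κ T : Type*} [Fintype ι] [Fintype κ]

/-- The matrix with entries `z (i, j)`. -/
def matrixOf {ι κ : Type*} (z : ι × κ → ℝ) : Matrix ι κ ℝ :=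
  Matrix.of (Function.curry z)

/-- The coefficients of the linear form `z ↦ uᵀ Z v` in the entries `z` of a matrix `Z`. -/
def bilinCoeff {ι κ : Type*} (u : ι → ℝ) (v : κ → ℝ) : ι × κ → ℝ :=
  fun ij => u ij.1 * v ij.2

lemma bilinCoeff_dotProduct (u : ι → ℝ) (v : κ → ℝ) (z : ι × κ → ℝ) :
    bilinCoeff u v ⬝ᵥ z = u ⬝ᵥ matrixOf z *ᵥ v := by
  simp only [dotProduct, bilinCoeff, matrixOf, Matrix.mulVec, Matrix.of_apply,
    Function.curry_apply, Fintype.sum_prod_type, Finset.mul_sum]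
  exact Finset.sum_congr rfl fun i _ => Finset.sum_congr rfl fun j _ => by ring

lemma bilinCoeff_dotProduct_bilinCoeff (u u' : ι → ℝ) (v v' : κ → ℝ) :
    bilinCoeff u v ⬝ᵥ bilinCoeff u' v' = (u ⬝ᵥ u') * (v ⬝ᵥ v') := by
  simp only [dotProduct, bilinCoeff, Fintype.sum_mul_sum, Fintype.sum_prod_type]
  exact Finset.sum_congr rfl fun i _ => Finset.sum_congr rfl fun j _ => by ring

lemma dotProduct_self_nonneg (v : ι → ℝ) : 0 ≤ v ⬝ᵥ v :=
  Finset.sum_nonneg fun i _ => mul_self_nonneg (v i)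

lemma dotProduct_le_sqrt_mul_sqrt (u v : ι → ℝ) : u ⬝ᵥ v ≤ √(u ⬝ᵥ u) * √(v ⬝ᵥ v) := by
  simpa only [dotProduct, ← sq] using Real.sum_mul_le_sqrt_mul_sqrt Finset.univ u v

lemma dotProduct_le_one {u v : ι → ℝ} (hu : u ⬝ᵥ u = 1) (hv : v ⬝ᵥ v = 1) : u ⬝ᵥ v ≤ 1 := by
  simpa [hu, hv] using dotProduct_le_sqrt_mul_sqrt u v

lemma integral_exp_mul_eval_gaussianPi (l : ℝ) (i : ι) :
    ∫ x, Real.exp (l * x i) ∂gaussianPi ι = Real.exp (l ^ 2 / 2) := by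
  rw [integral_comp_eval (μ := fun _ : ι => gaussianReal 0 1) (i := i)
    (f := fun t => Real.exp (l * t)) (by fun_prop)]
  simpa [mgf] using congrFun (mgf_id_gaussianReal (μ := 0) (v := 1)) l

lemma integral_exp_sq_gaussianReal {a : ℝ} (ha : a < 1) :
    ∫ x, Real.exp (a * x ^ 2 / 2) ∂gaussianReal 0 1 = (√(1 - a))⁻¹ := by
  have h1 : 0 < 1 - a := by linarith
  have hdens (x : ℝ) : gaussianPDFReal 0 1 x • Real.exp (a * x ^ 2 / 2) =
      (√(2 * Real.pi))⁻¹ * Real.exp (-((1 - a) / 2) * x ^ 2) := by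
    rw [gaussianPDFReal, smul_eq_mul, mul_assoc, ← Real.exp_add]
    simp only [NNReal.coe_one, sub_zero, mul_one]
    congr 2
    ring
  rw [integral_gaussianReal_eq_integral_smul one_ne_zero]
  simp only [hdens]
  rw [integral_const_mul, integral_gaussian, ← Real.sqrt_inv, ← Real.sqrt_inv,
    ← Real.sqrt_mul (by positivity)]
  congr 1
  field_simp

lemma integrable_exp_sq_gaussianReal {a : ℝ} (ha : a < 1) :
    Integrable (fun x => Real.exp (a * x ^ 2 / 2)) (gaussianReal 0 1) := by
  refine Integrable.of_integral_ne_zero ?_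
  rw [integral_exp_sq_gaussianReal ha]
  exact (inv_pos.2 (Real.sqrt_pos.2 (sub_pos.2 ha))).ne'

lemma exp_mul_dotProduct_self_eq_prod (a : ℝ) (x : ι → ℝ) :
    Real.exp (a * (x ⬝ᵥ x) / 2) = ∏ i, Real.exp (a * x i ^ 2 / 2) := by
  rw [← Real.exp_sum, ← Finset.sum_div, ← Finset.mul_sum]
  simp only [dotProduct, sq]

lemma integral_exp_mul_dotProduct_self_gaussianPi {a : ℝ} (ha : a < 1) :
    ∫ x, Real.exp (a * (x ⬝ᵥ x) / 2) ∂gaussianPi ι = (√(1 - a))⁻¹ ^ Fintype.card ι := by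
  simp only [exp_mul_dotProduct_self_eq_prod]
  rw [integral_fintype_prod_eq_pow (fun x => Real.exp (a * x ^ 2 / 2)),
    integral_exp_sq_gaussianReal ha]

lemma integrable_exp_mul_dotProduct_self_gaussianPi {a : ℝ} (ha : a < 1) :
    Integrable (fun x => Real.exp (a * (x ⬝ᵥ x) / 2)) (gaussianPi ι) := by
  simp only [exp_mul_dotProduct_self_eq_prod]
  exact Integrable.fintype_prod fun _ => integrable_exp_sq_gaussianReal ha

lemma integrable_exp_mul_sqrt_dotProduct_self_gaussianPi (l : ℝ) :
    Integrable (fun x => Real.exp (l * √(x ⬝ᵥ x))) (gaussianPi ι) := by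
  refine ((integrable_exp_mul_dotProduct_self_gaussianPi (a := 1 / 2) (by norm_num)).const_mul
    (Real.exp (l ^ 2))).mono' (by simp only [dotProduct]; fun_prop) (.of_forall fun x => ?_)
  have hx : √(x ⬝ᵥ x) ^ 2 = x ⬝ᵥ x := Real.sq_sqrt (dotProduct_self_nonneg x)
  rw [Real.norm_of_nonneg (Real.exp_pos _).le, ← Real.exp_add, Real.exp_le_exp]
  nlinarith [sq_nonneg (√(x ⬝ᵥ x) - 2 * l)]

lemma mul_le_div_add_mul_sq {a : ℝ} (ha : 0 < a) (l r : ℝ) :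
    l * r ≤ l ^ 2 / (2 * a) + a * r ^ 2 / 2 := by
  have hsq : l ^ 2 / (2 * a) + a * r ^ 2 / 2 - l * r = (l - a * r) ^ 2 / (2 * a) := by
    field_simp
    ring
  rw [← sub_nonneg, hsq]
  positivity

lemma integral_exp_mul_sqrt_dotProduct_self_gaussianPi_le_mul {a : ℝ} (ha0 : 0 < a) (ha1 : a < 1)
    (l : ℝ) : ∫ x, Real.exp (l * √(x ⬝ᵥ x)) ∂gaussianPi ι ≤
      Real.exp (l ^ 2 / (2 * a)) * (√(1 - a))⁻¹ ^ Fintype.card ι := by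
  rw [← integral_exp_mul_dotProduct_self_gaussianPi ha1, ← integral_const_mul]
  refine integral_mono (integrable_exp_mul_sqrt_dotProduct_self_gaussianPi l)
    ((integrable_exp_mul_dotProduct_self_gaussianPi ha1).const_mul _) fun x => ?_
  rw [← Real.exp_add, Real.exp_le_exp]
  simpa only [Real.sq_sqrt (dotProduct_self_nonneg x)] using
    mul_le_div_add_mul_sq ha0 l √(x ⬝ᵥ x)

lemma inv_sqrt_one_sub_div_one_add_le {s : ℝ} (hs : 0 ≤ s) :
    (√(1 - s / (1 + s)))⁻¹ ≤ Real.exp (s / 2) := by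
  have hinv : (1 - s / (1 + s))⁻¹ = 1 + s := by
    field_simp
    ring
  rw [← Real.sqrt_inv, hinv, Real.exp_half]
  exact Real.sqrt_le_sqrt (by linarith [Real.add_one_le_exp s])

lemma integral_exp_mul_sqrt_dotProduct_self_gaussianPi_le {l : ℝ} (hl : 0 < l) :
    ∫ x, Real.exp (l * √(x ⬝ᵥ x)) ∂gaussianPi ι ≤
      Real.exp (l * √(Fintype.card ι) + l ^ 2 / 2) := by
  rcases isEmpty_or_nonempty ι with _ | _
  · simpa using by positivity
  set r : ℝ := √(Fintype.card ι)
  have hr0 : 0 < r := Real.sqrt_pos.2 (by exact_mod_cast Fintype.card_pos)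
  have hr2 : (Fintype.card ι : ℝ) = r ^ 2 := (Real.sq_sqrt (by positivity)).symm
  have hs : 0 < l / r := by positivity
  -- this choice of `a` splits the exponent evenly between the two factors
  calc ∫ x, Real.exp (l * √(x ⬝ᵥ x)) ∂gaussianPi ι
      ≤ Real.exp (l ^ 2 / (2 * (l / r / (1 + l / r)))) *
          (√(1 - l / r / (1 + l / r)))⁻¹ ^ Fintype.card ι :=
        integral_exp_mul_sqrt_dotProduct_self_gaussianPi_le_mul (by positivity)
          ((div_lt_one (by positivity)).2 (by linarith)) l
    _ ≤ Real.exp (l ^ 2 / (2 * (l / r / (1 + l / r)))) *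
          Real.exp (l / r / 2) ^ Fintype.card ι := by
        gcongr
        exact inv_sqrt_one_sub_div_one_add_le hs.le
    _ = Real.exp (l * r + l ^ 2 / 2) := by
        rw [← Real.exp_nat_mul, ← Real.exp_add, hr2]
        congr 1
        field_simp
        ring

/-- The coefficients of the Gaussian process `uᵀ Z v + w`, indexed by the pairs `(u τ, v τ)`, in the
entries of `Z` and the extra variable `w`. -/
def bilinProcess (u : T → ι → ℝ) (v : T → κ → ℝ) : Matrix T ((ι × κ) ⊕ Unit) ℝ :=
  Matrix.of fun τ => Sum.elim (bilinCoeff (u τ) (v τ)) 1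

/-- The coefficients of the Gaussian process `⟨u, g⟩ + ⟨v, h⟩`, indexed by the pairs `(u τ, v τ)`,
in the entries of `g` and `h`. -/
def sumProcess (u : T → ι → ℝ) (v : T → κ → ℝ) : Matrix T (ι ⊕ κ) ℝ :=
  Matrix.of fun τ => Sum.elim (u τ) (v τ)

lemma bilinProcess_mulVec (u : T → ι → ℝ) (v : T → κ → ℝ) (x : (ι × κ) ⊕ Unit → ℝ) (τ : T) :
    (bilinProcess u v *ᵥ x) τ = u τ ⬝ᵥ matrixOf (x ∘ Sum.inl) *ᵥ v τ + x (Sum.inr ()) := by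
  rw [← bilinCoeff_dotProduct]
  simp [bilinProcess, Matrix.mulVec, dotProduct]

lemma sumProcess_mulVec (u : T → ι → ℝ) (v : T → κ → ℝ) (y : ι ⊕ κ → ℝ) (τ : T) :
    (sumProcess u v *ᵥ y) τ = u τ ⬝ᵥ (y ∘ Sum.inl) + v τ ⬝ᵥ (y ∘ Sum.inr) := by
  simp [sumProcess, Matrix.mulVec, dotProduct]

lemma bilinProcess_mul_transpose (u : T → ι → ℝ) (v : T → κ → ℝ) (τ σ : T) :
    (bilinProcess u v * (bilinProcess u v)ᵀ) τ σ = (u τ ⬝ᵥ u σ) * (v τ ⬝ᵥ v σ) + 1 := by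
  rw [← bilinCoeff_dotProduct_bilinCoeff]
  simp [bilinProcess, Matrix.mul_apply, dotProduct]

lemma sumProcess_mul_transpose (u : T → ι → ℝ) (v : T → κ → ℝ) (τ σ : T) :
    (sumProcess u v * (sumProcess u v)ᵀ) τ σ = u τ ⬝ᵥ u σ + v τ ⬝ᵥ v σ := by
  simp [sumProcess, Matrix.mul_apply, dotProduct]

variable [Finite T] [Nonempty T]

lemma integral_exp_mul_iSup_bilinProcess (u : T → ι → ℝ) (v : T → κ → ℝ) (l : ℝ) :
    ∫ x, Real.exp (l * ⨆ τ, (bilinProcess u v *ᵥ x) τ) ∂gaussianPi ((ι × κ) ⊕ Unit) =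
      (∫ z, Real.exp (l * ⨆ τ, u τ ⬝ᵥ matrixOf z *ᵥ v τ) ∂gaussianPi (ι × κ)) *
        Real.exp (l ^ 2 / 2) := by
  rw [← integral_exp_mul_eval_gaussianPi l (), ← integral_comp_inl_mul_comp_inr_gaussianPi]
  refine integral_congr_ae (.of_forall fun x => ?_)
  simp only [bilinProcess_mulVec, Function.comp_apply]
  rw [← ciSup_add (Set.finite_range _).bddAbove, mul_add, Real.exp_add]

lemma integral_exp_mul_iSup_sumProcess_le {u : T → ι → ℝ} {v : T → κ → ℝ}
    (hu : ∀ τ, u τ ⬝ᵥ u τ = 1) (hv : ∀ τ, v τ ⬝ᵥ v τ = 1) {l : ℝ} (hl : 0 < l) :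
    ∫ y, Real.exp (l * ⨆ τ, (sumProcess u v *ᵥ y) τ) ∂gaussianPi (ι ⊕ κ) ≤
      Real.exp (l * √(Fintype.card ι) + l ^ 2 / 2) *
        Real.exp (l * √(Fintype.card κ) + l ^ 2 / 2) := by
  have hpt (y : ι ⊕ κ → ℝ) : Real.exp (l * ⨆ τ, (sumProcess u v *ᵥ y) τ) ≤
      Real.exp (l * √((y ∘ Sum.inl) ⬝ᵥ (y ∘ Sum.inl))) *
        Real.exp (l * √((y ∘ Sum.inr) ⬝ᵥ (y ∘ Sum.inr))) := by
    rw [← Real.exp_add, Real.exp_le_exp, ← mul_add]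
    refine mul_le_mul_of_nonneg_left (ciSup_le fun τ => ?_) hl.le
    rw [sumProcess_mulVec]
    gcongr
    · simpa [hu τ] using dotProduct_le_sqrt_mul_sqrt (u τ) (y ∘ Sum.inl)
    · simpa [hv τ] using dotProduct_le_sqrt_mul_sqrt (v τ) (y ∘ Sum.inr)
  calc _ ≤ ∫ y, Real.exp (l * √((y ∘ Sum.inl) ⬝ᵥ (y ∘ Sum.inl))) *
        Real.exp (l * √((y ∘ Sum.inr) ⬝ᵥ (y ∘ Sum.inr))) ∂gaussianPi (ι ⊕ κ) :=
        integral_mono (integrable_exp_mul_iSup_mulVec l _)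
          (integrable_comp_inl_mul_comp_inr_gaussianPi
            (integrable_exp_mul_sqrt_dotProduct_self_gaussianPi l)
            (integrable_exp_mul_sqrt_dotProduct_self_gaussianPi l)) hpt
    _ = (∫ g, Real.exp (l * √(g ⬝ᵥ g)) ∂gaussianPi ι) *
        ∫ h, Real.exp (l * √(h ⬝ᵥ h)) ∂gaussianPi κ :=
        integral_comp_inl_mul_comp_inr_gaussianPi (fun g : ι → ℝ => Real.exp (l * √(g ⬝ᵥ g)))
          fun h : κ → ℝ => Real.exp (l * √(h ⬝ᵥ h))
    _ ≤ _ := mul_le_mul (integral_exp_mul_sqrt_dotProduct_self_gaussianPi_le hl)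
        (integral_exp_mul_sqrt_dotProduct_self_gaussianPi_le hl)
        (integral_nonneg fun _ => (Real.exp_pos _).le) (Real.exp_pos _).le

theorem chevet_integral_exp_mul_iSup_le {u : T → ι → ℝ} {v : T → κ → ℝ}
    (hu : ∀ τ, u τ ⬝ᵥ u τ = 1) (hv : ∀ τ, v τ ⬝ᵥ v τ = 1) {l : ℝ} (hl : 0 < l) :
    ∫ z, Real.exp (l * ⨆ τ, u τ ⬝ᵥ matrixOf z *ᵥ v τ) ∂gaussianPi (ι × κ) ≤
      Real.exp (l * (√(Fintype.card ι) + √(Fintype.card κ)) + l ^ 2 / 2) := by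
  have hcov (τ σ : T) : (sumProcess u v * (sumProcess u v)ᵀ) τ σ ≤
      (bilinProcess u v * (bilinProcess u v)ᵀ) τ σ := by
    rw [sumProcess_mul_transpose, bilinProcess_mul_transpose]
    nlinarith [mul_nonneg (sub_nonneg.2 (dotProduct_le_one (hu τ) (hu σ)))
      (sub_nonneg.2 (dotProduct_le_one (hv τ) (hv σ)))]
  have hvar (τ : T) : (bilinProcess u v * (bilinProcess u v)ᵀ) τ τ =
      (sumProcess u v * (sumProcess u v)ᵀ) τ τ := by
    rw [sumProcess_mul_transpose, bilinProcess_mul_transpose, hu, hv, mul_one]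
  have hcomp := (slepian_integral_exp_mul_iSup_mulVec_le hvar hcov hl).trans
    (integral_exp_mul_iSup_sumProcess_le hu hv hl)
  rw [integral_exp_mul_iSup_bilinProcess, ← Real.exp_add, ← le_div_iff₀ (Real.exp_pos _),
    ← Real.exp_sub] at hcomp
  exact hcomp.trans_eq (congrArg Real.exp (by ring))

end Chevet

section OperatorNorm

variable {m n : ℕ}

lemma vecNorm_two_sq (v : Fin n → ℝ) : vecNorm 2 v ^ 2 = v ⬝ᵥ v := by
  simp [vecNorm, EuclideanSpace.real_norm_sq_eq, dotProduct, ← sq]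

lemma vecNorm_two_eq_one_iff {v : Fin n → ℝ} : vecNorm 2 v = 1 ↔ v ⬝ᵥ v = 1 := by
  rw [← vecNorm_two_sq, pow_eq_one_iff_of_nonneg (a := vecNorm 2 v) (norm_nonneg _) two_ne_zero]

lemma matNorm_nonneg (p : ℝ≥0∞) [Fact (1 ≤ p)] (M : Matrix (Fin m) (Fin n) ℝ) :
    0 ≤ matNorm p M := norm_nonneg _

lemma dotProduct_mulVec_le_matNorm {u : Fin m → ℝ} {v : Fin n → ℝ} (hu : u ⬝ᵥ u = 1)
    (hv : v ⬝ᵥ v = 1) (M : Matrix (Fin m) (Fin n) ℝ) : u ⬝ᵥ M *ᵥ v ≤ matNorm 2 M := by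
  have hu' : ‖WithLp.toLp 2 u‖ = 1 := vecNorm_two_eq_one_iff.2 hu
  have hv' : ‖WithLp.toLp 2 v‖ = 1 := vecNorm_two_eq_one_iff.2 hv
  calc u ⬝ᵥ M *ᵥ v ≤ ‖WithLp.toLp 2 (M *ᵥ v)‖ * ‖WithLp.toLp 2 u‖ :=
        real_inner_le_norm (WithLp.toLp 2 (M *ᵥ v)) (WithLp.toLp 2 u)
    _ ≤ matNorm 2 M * ‖WithLp.toLp 2 v‖ * ‖WithLp.toLp 2 u‖ := by
        gcongr
        exact (Matrix.toLpLin 2 2 M).toContinuousLinearMap.le_opNorm (WithLp.toLp 2 v)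
    _ = matNorm 2 M := by rw [hu', hv', mul_one, mul_one]

lemma matNorm_two_le {M : Matrix (Fin m) (Fin n) ℝ} {t : ℝ} (ht : 0 ≤ t)
    (h : ∀ u v, u ⬝ᵥ u = 1 → v ⬝ᵥ v = 1 → u ⬝ᵥ M *ᵥ v ≤ t) : matNorm 2 M ≤ t :=
  ContinuousLinearMap.opNorm_le_of_re_inner_le (𝕜 := ℝ) ht fun x y hx hy =>
    h y.ofLp x.ofLp (vecNorm_two_eq_one_iff.1 hy) (vecNorm_two_eq_one_iff.1 hx)

lemma exists_seq_isLUB_matNorm_two (hm : 0 < m) (hn : 0 < n) :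
    ∃ (u : ℕ → Fin m → ℝ) (v : ℕ → Fin n → ℝ), (∀ k, u k ⬝ᵥ u k = 1) ∧ (∀ k, v k ⬝ᵥ v k = 1) ∧
      ∀ M, IsLUB (Set.range fun k => u k ⬝ᵥ M *ᵥ v k) (matNorm 2 M) := by
  let U := {w : (Fin m → ℝ) × (Fin n → ℝ) // w.1 ⬝ᵥ w.1 = 1 ∧ w.2 ⬝ᵥ w.2 = 1}
  let e : Fin m → ℝ := Pi.single ⟨0, hm⟩ 1
  let e' : Fin n → ℝ := Pi.single ⟨0, hn⟩ 1
  have he : e ⬝ᵥ e = 1 := by simp [e]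
  have he' : e' ⬝ᵥ e' = 1 := by simp [e']
  have : Nonempty U := ⟨⟨(e, e'), he, he'⟩⟩
  let w : ℕ → U := TopologicalSpace.denseSeq U
  refine ⟨fun k => (w k).1.1, fun k => (w k).1.2, fun k => (w k).2.1, fun k => (w k).2.2,
    fun M => ⟨?_, fun t ht => ?_⟩⟩
  · rintro _ ⟨k, rfl⟩
    exact dotProduct_mulVec_le_matNorm (w k).2.1 (w k).2.2 M
  · have hclosed : IsClosed {x : U | x.1.1 ⬝ᵥ M *ᵥ x.1.2 ≤ t} :=
        isClosed_le (by fun_prop) (by fun_prop)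
    have hle (x : U) : x.1.1 ⬝ᵥ M *ᵥ x.1.2 ≤ t :=
      (TopologicalSpace.denseRange_denseSeq U).induction_on x hclosed fun k => ht ⟨k, rfl⟩
    have hneg : -(e ⬝ᵥ M *ᵥ e') ≤ t := by
      simpa only [neg_dotProduct] using hle ⟨(-e, e'), by simpa using he, he'⟩
    have ht0 : 0 ≤ t := by linarith [hle ⟨(e, e'), he, he'⟩]
    exact matNorm_two_le ht0 fun u v hu hv => hle ⟨(u, v), hu, hv⟩

lemma matNorm_two_eq_zero_of_not_pos (h : ¬(0 < m ∧ 0 < n)) (M : Matrix (Fin m) (Fin n) ℝ) :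
    matNorm 2 M = 0 := by
  refine le_antisymm (matNorm_two_le le_rfl fun u v hu hv => ?_) (matNorm_nonneg 2 M)
  obtain rfl | rfl : m = 0 ∨ n = 0 := by lia
  all_goals simp at hu hv

lemma tendsto_iSup_fin_succ_of_isLUB {x : ℕ → ℝ} {a : ℝ} (h : IsLUB (Set.range x) a) :
    Tendsto (fun N => ⨆ k : Fin (N + 1), x k) atTop (nhds a) := by
  have hbdd (N : ℕ) : BddAbove (Set.range fun k : Fin (N + 1) => x k) :=
    (Set.finite_range _).bddAbove
  refine tendsto_atTop_isLUB (fun N N' hN => ciSup_le fun k => ?_) ⟨?_, fun t ht => h.2 ?_⟩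
  · exact le_ciSup (hbdd N') (Fin.castLE (by lia) k)
  · rintro _ ⟨N, rfl⟩
    exact ciSup_le fun k => h.1 ⟨k, rfl⟩
  · rintro _ ⟨k, rfl⟩
    exact (le_ciSup (hbdd k) (Fin.last k)).trans (ht ⟨k, rfl⟩)

lemma exists_continuousLinearMap_norm_eq_matNorm_matrixOf (p : ℝ≥0∞) [Fact (1 ≤ p)] :
    ∃ L : (Fin m × Fin n → ℝ) →L[ℝ] PiLp p (fun _ : Fin n => ℝ) →L[ℝ] PiLp p (fun _ : Fin m => ℝ),
      ∀ z, ‖L z‖ = matNorm p (matrixOf z) :=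
  ⟨(((LinearEquiv.curry ℝ ℝ (Fin m) (Fin n)).trans (Matrix.ofLinearEquiv ℝ)).trans
    ((Matrix.toLpLin p p).trans LinearMap.toContinuousLinearMap)).toLinearMap.toContinuousLinearMap,
    fun _ => rfl⟩

lemma continuous_matNorm_matrixOf (p : ℝ≥0∞) [Fact (1 ≤ p)] :
    Continuous fun z : Fin m × Fin n → ℝ => matNorm p (matrixOf z) := by
  obtain ⟨L, hL⟩ := exists_continuousLinearMap_norm_eq_matNorm_matrixOf (m := m) (n := n) p
  simpa only [hL] using L.continuous.norm

lemma hasExpGrowth_matNorm_matrixOf (p : ℝ≥0∞) [Fact (1 ≤ p)] :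
    HasExpGrowth fun z : Fin m × Fin n → ℝ => matNorm p (matrixOf z) := by
  obtain ⟨L, hL⟩ := exists_continuousLinearMap_norm_eq_matNorm_matrixOf (m := m) (n := n) p
  simpa only [hL] using hasExpGrowth_norm.comp_of_norm_le L.le_opNorm

lemma integrable_matNorm_matrixOf (p : ℝ≥0∞) [Fact (1 ≤ p)] :
    Integrable (fun z => matNorm p (matrixOf z)) (gaussianPi (Fin m × Fin n)) :=
  (hasExpGrowth_matNorm_matrixOf p).integrable_gaussianPi (continuous_matNorm_matrixOf p)

lemma integrable_exp_mul_matNorm_matrixOf (p : ℝ≥0∞) [Fact (1 ≤ p)] (l : ℝ) :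
    Integrable (fun z => Real.exp (l * matNorm p (matrixOf z))) (gaussianPi (Fin m × Fin n)) := by
  obtain ⟨L, hL⟩ := exists_continuousLinearMap_norm_eq_matNorm_matrixOf (m := m) (n := n) p
  simpa only [hL] using ((hasExpGrowth_exp_mul_norm l).comp_of_norm_le
    L.le_opNorm).integrable_gaussianPi
    (Real.continuous_exp.comp (continuous_const.mul L.continuous.norm))

theorem integral_exp_mul_matNorm_two_matrixOf_le {l : ℝ} (hl : 0 < l) :
    ∫ z, Real.exp (l * matNorm 2 (matrixOf z)) ∂gaussianPi (Fin m × Fin n) ≤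
      Real.exp (l * (√m + √n) + l ^ 2 / 2) := by
  by_cases hmn : 0 < m ∧ 0 < n
  swap
  · simpa [matNorm_two_eq_zero_of_not_pos hmn] using by positivity
  obtain ⟨u, v, hu, hv, hlub⟩ := exists_seq_isLUB_matNorm_two hmn.1 hmn.2
  have hle (N : ℕ) (z : Fin m × Fin n → ℝ) :
      ⨆ k : Fin (N + 1), u k ⬝ᵥ matrixOf z *ᵥ v k ≤ matNorm 2 (matrixOf z) :=
    ciSup_le fun k => (hlub (matrixOf z)).1 ⟨k, rfl⟩
  have hcont (N : ℕ) : Continuous fun z : Fin m × Fin n → ℝ =>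
      ⨆ k : Fin (N + 1), u k ⬝ᵥ matrixOf z *ᵥ v k := by
    simp only [← bilinCoeff_dotProduct]
    exact continuous_iSup_apply.comp (by fun_prop)
  have hlim : Tendsto (fun N => ∫ z, Real.exp (l * ⨆ k : Fin (N + 1), u k ⬝ᵥ matrixOf z *ᵥ v k)
      ∂gaussianPi (Fin m × Fin n)) atTop
      (nhds (∫ z, Real.exp (l * matNorm 2 (matrixOf z)) ∂gaussianPi (Fin m × Fin n))) := by
    refine tendsto_integral_of_dominated_convergence _
      (fun N => (Real.continuous_exp.comp (continuous_const.mul (hcont N))).aestronglyMeasurable)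
      (integrable_exp_mul_matNorm_matrixOf 2 l) (fun N => .of_forall fun z => ?_)
      (.of_forall fun z => ?_)
    · rw [Real.norm_of_nonneg (Real.exp_pos _).le, Real.exp_le_exp]
      exact mul_le_mul_of_nonneg_left (hle N z) hl.le
    · exact Real.continuous_exp.continuousAt.tendsto.comp
        ((tendsto_iSup_fin_succ_of_isLUB (hlub (matrixOf z))).const_mul l)
  refine le_of_tendsto' hlim fun N => ?_
  simpa only [Fintype.card_fin] using chevet_integral_exp_mul_iSup_le (T := Fin (N + 1))
    (fun k => hu k) (fun k => hv k) hl

theorem measureReal_matNorm_two_matrixOf_ge_le {ε : ℝ} (hε : 0 < ε) :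
    (gaussianPi (Fin m × Fin n)).real {z | √m + √n + ε ≤ matNorm 2 (matrixOf z)} ≤
      Real.exp (-ε ^ 2 / 2) := by
  calc _ ≤ Real.exp (-ε * (√m + √n + ε)) *
        mgf (fun z => matNorm 2 (matrixOf z)) (gaussianPi (Fin m × Fin n)) ε :=
        measure_ge_le_exp_mul_mgf _ hε.le (integrable_exp_mul_matNorm_matrixOf 2 ε)
    _ ≤ Real.exp (-ε * (√m + √n + ε)) * Real.exp (ε * (√m + √n) + ε ^ 2 / 2) := by
        gcongr
        exact integral_exp_mul_matNorm_two_matrixOf_le hε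
    _ = Real.exp (-ε ^ 2 / 2) := by
        rw [← Real.exp_add]
        congr 1
        ring

theorem one_sub_exp_le_measureReal_matNorm_two_matrixOf_le {ε : ℝ} (hε : 0 < ε) :
    1 - Real.exp (-ε ^ 2 / 2) ≤
      (gaussianPi (Fin m × Fin n)).real {z | matNorm 2 (matrixOf z) ≤ √m + √n + ε} := by
  have hmeas : MeasurableSet {z : Fin m × Fin n → ℝ | matNorm 2 (matrixOf z) ≤ √m + √n + ε} :=
    measurableSet_le (continuous_matNorm_matrixOf 2).measurable measurable_const
  have hcompl : {z : Fin m × Fin n → ℝ | matNorm 2 (matrixOf z) ≤ √m + √n + ε}ᶜ ⊆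
      {z | √m + √n + ε ≤ matNorm 2 (matrixOf z)} := fun z hz => by
    rw [Set.mem_compl_iff, Set.mem_ofPred_eq, not_le] at hz
    exact hz.le
  have htail := (measureReal_mono hcompl).trans (measureReal_matNorm_two_matrixOf_ge_le hε)
  rw [probReal_compl_eq_one_sub hmeas] at htail
  linarith

theorem integral_matNorm_two_matrixOf_le :
    ∫ z, matNorm 2 (matrixOf z) ∂gaussianPi (Fin m × Fin n) ≤ √m + √n + 1 / 2 := by
  have hjensen := convexOn_exp.map_integral_le (μ := gaussianPi (Fin m × Fin n))
    (f := fun z => matNorm 2 (matrixOf z)) Real.continuous_exp.continuousOn isClosed_univ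
    (.of_forall fun _ => Set.mem_univ _) (integrable_matNorm_matrixOf 2)
    (by simpa [Function.comp_def] using integrable_exp_mul_matNorm_matrixOf 2 1)
  have hmgf := integral_exp_mul_matNorm_two_matrixOf_le (m := m) (n := n) one_pos
  simp only [one_mul, one_pow] at hmgf
  exact Real.exp_le_exp.1 (hjensen.trans hmgf)

end OperatorNorm

section Moments

variable {ι : Type*} [Fintype ι]

lemma hasExpGrowth_dotProduct (w : ι → ℝ) : HasExpGrowth fun z => w ⬝ᵥ z :=
  HasExpGrowth.sum fun i _ => (HasExpGrowth.const (w i)).mul (hasExpGrowth_eval i)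

lemma hasLineDerivAt_dotProduct (w v z : ι → ℝ) :
    HasLineDerivAt ℝ (fun z => w ⬝ᵥ z) (w ⬝ᵥ v) z v := by
  simpa [HasLineDerivAt, dotProduct_add, dotProduct_smul] using
    ((hasDerivAt_id (0 : ℝ)).mul_const (w ⬝ᵥ v)).const_add (w ⬝ᵥ z)

lemma integrable_dotProduct_pow_mul_pow (l m : ι → ℝ) (j k : ℕ) :
    Integrable (fun z => (l ⬝ᵥ z) ^ j * (m ⬝ᵥ z) ^ k) (gaussianPi ι) :=
  (((hasExpGrowth_dotProduct l).pow j).mul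
    ((hasExpGrowth_dotProduct m).pow k)).integrable_gaussianPi (by fun_prop)

lemma integral_dotProduct_mul_dotProduct (l m : ι → ℝ) :
    ∫ z, (l ⬝ᵥ z) * (m ⬝ᵥ z) ∂gaussianPi ι = m ⬝ᵥ l := by
  rw [gaussianPi_stein_identity (g' := fun _ => m ⬝ᵥ l) (hasLineDerivAt_dotProduct m l)
    (by simpa using integrable_dotProduct_pow_mul_pow l m 0 1) (integrable_const _)
    (by simpa using integrable_dotProduct_pow_mul_pow l m 1 1)]
  simp

lemma integral_dotProduct_sq (l : ι → ℝ) : ∫ z, (l ⬝ᵥ z) ^ 2 ∂gaussianPi ι = l ⬝ᵥ l := by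
  simp only [sq, integral_dotProduct_mul_dotProduct]

lemma hasLineDerivAt_dotProduct_mul_sq (l m v z : ι → ℝ) :
    HasLineDerivAt ℝ (fun z => (l ⬝ᵥ z) * (m ⬝ᵥ z) ^ 2)
      ((l ⬝ᵥ v) * (m ⬝ᵥ z) ^ 2 + 2 * (m ⬝ᵥ v) * ((l ⬝ᵥ z) * (m ⬝ᵥ z))) z v :=
  ((hasLineDerivAt_dotProduct l v z).fun_mul
    ((hasLineDerivAt_dotProduct m v z).fun_pow 2)).congr_deriv (by
      simp only [zero_smul, add_zero, Nat.cast_ofNat, Nat.add_one_sub_one, pow_one]; ring)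

lemma integral_dotProduct_sq_mul_sq (l m : ι → ℝ) :
    ∫ z, (l ⬝ᵥ z) ^ 2 * (m ⬝ᵥ z) ^ 2 ∂gaussianPi ι =
      (l ⬝ᵥ l) * (m ⬝ᵥ m) + 2 * (m ⬝ᵥ l) ^ 2 := by
  have hi := integrable_dotProduct_pow_mul_pow l m
  have h02 : Integrable (fun z => (l ⬝ᵥ l) * (m ⬝ᵥ z) ^ 2) (gaussianPi ι) := by
    simpa using (hi 0 2).const_mul (l ⬝ᵥ l)
  have h11 : Integrable (fun z => 2 * (m ⬝ᵥ l) * ((l ⬝ᵥ z) * (m ⬝ᵥ z))) (gaussianPi ι) := by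
    simpa using (hi 1 1).const_mul (2 * (m ⬝ᵥ l))
  have hsq (z : ι → ℝ) :
      (l ⬝ᵥ z) ^ 2 * (m ⬝ᵥ z) ^ 2 = (l ⬝ᵥ z) * ((l ⬝ᵥ z) * (m ⬝ᵥ z) ^ 2) := by ring
  calc ∫ z, (l ⬝ᵥ z) ^ 2 * (m ⬝ᵥ z) ^ 2 ∂gaussianPi ι
      = ∫ z, ((l ⬝ᵥ l) * (m ⬝ᵥ z) ^ 2 + 2 * (m ⬝ᵥ l) * ((l ⬝ᵥ z) * (m ⬝ᵥ z))) ∂gaussianPi ι := by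
        simp only [hsq]
        exact gaussianPi_stein_identity (hasLineDerivAt_dotProduct_mul_sq l m l)
          (by simpa using hi 1 2) (h02.add h11) (by simpa only [hsq] using hi 2 2)
    _ = (l ⬝ᵥ l) * (m ⬝ᵥ m) + 2 * (m ⬝ᵥ l) ^ 2 := by
        rw [integral_add h02 h11, integral_const_mul, integral_const_mul,
          integral_dotProduct_sq, integral_dotProduct_mul_dotProduct]
        ring

end Moments

section MatrixMoments

variable {m n : ℕ}

lemma integrable_dotProduct_mulVec_sq (c : Fin m → ℝ) (b : Fin n → ℝ) :
    Integrable (fun z => (c ⬝ᵥ matrixOf z *ᵥ b) ^ 2) (gaussianPi (Fin m × Fin n)) := by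
  simpa [bilinCoeff_dotProduct] using
    integrable_dotProduct_pow_mul_pow (bilinCoeff c b) (bilinCoeff c b) 2 0

lemma integrable_dotProduct_mulVec (c : Fin m → ℝ) (b : Fin n → ℝ) :
    Integrable (fun z => c ⬝ᵥ matrixOf z *ᵥ b) (gaussianPi (Fin m × Fin n)) := by
  simpa [bilinCoeff_dotProduct] using
    integrable_dotProduct_pow_mul_pow (bilinCoeff c b) (bilinCoeff c b) 1 0

lemma integral_dotProduct_mulVec_sq (c : Fin m → ℝ) (b : Fin n → ℝ) :
    ∫ z, (c ⬝ᵥ matrixOf z *ᵥ b) ^ 2 ∂gaussianPi (Fin m × Fin n) = (c ⬝ᵥ c) * (b ⬝ᵥ b) := by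
  simp only [← bilinCoeff_dotProduct, integral_dotProduct_sq, bilinCoeff_dotProduct_bilinCoeff]

lemma integral_abs_dotProduct_mulVec_le (c : Fin m → ℝ) (b : Fin n → ℝ) :
    ∫ z, |c ⬝ᵥ matrixOf z *ᵥ b| ∂gaussianPi (Fin m × Fin n) ≤ 1 + (c ⬝ᵥ c) * (b ⬝ᵥ b) := by
  have habs (x : ℝ) : |x| ≤ 1 + x ^ 2 := by nlinarith [sq_abs x, sq_nonneg (|x| - 1)]
  calc ∫ z, |c ⬝ᵥ matrixOf z *ᵥ b| ∂gaussianPi (Fin m × Fin n)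
      ≤ ∫ z, (1 + (c ⬝ᵥ matrixOf z *ᵥ b) ^ 2) ∂gaussianPi (Fin m × Fin n) :=
        integral_mono (integrable_dotProduct_mulVec c b).abs
          ((integrable_const 1).add (integrable_dotProduct_mulVec_sq c b)) fun z => habs _
    _ = 1 + (c ⬝ᵥ c) * (b ⬝ᵥ b) := by
        rw [integral_add (integrable_const 1) (integrable_dotProduct_mulVec_sq c b),
          integral_dotProduct_mulVec_sq]
        simp

lemma bilinCoeff_single_left_dotProduct (b : Fin n → ℝ) (i : Fin m) (z : Fin m × Fin n → ℝ) :
    bilinCoeff (Pi.single i 1) b ⬝ᵥ z = (matrixOf z *ᵥ b) i := by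
  rw [bilinCoeff_dotProduct, single_one_dotProduct]

lemma bilinCoeff_single_right_dotProduct (c : Fin m → ℝ) (j : Fin n) (z : Fin m × Fin n → ℝ) :
    bilinCoeff c (Pi.single j 1) ⬝ᵥ z = ((matrixOf z)ᵀ *ᵥ c) j := by
  rw [bilinCoeff_dotProduct, Matrix.dotProduct_mulVec, dotProduct_single_one,
    Matrix.mulVec_transpose]

lemma vecNorm_hadamard_sq (b c : Fin n → ℝ) (z : Fin n × Fin n → ℝ) :
    vecNorm 2 ((matrixOf z *ᵥ b) * ((matrixOf z)ᵀ *ᵥ c)) ^ 2 =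
      ∑ i, (bilinCoeff (Pi.single i 1) b ⬝ᵥ z) ^ 2 * (bilinCoeff c (Pi.single i 1) ⬝ᵥ z) ^ 2 := by
  rw [vecNorm_two_sq, dotProduct]
  refine Finset.sum_congr rfl fun i _ => ?_
  rw [bilinCoeff_single_left_dotProduct, bilinCoeff_single_right_dotProduct, Pi.mul_apply]
  ring

lemma integrable_vecNorm_hadamard_sq (b c : Fin n → ℝ) :
    Integrable (fun z => vecNorm 2 ((matrixOf z *ᵥ b) * ((matrixOf z)ᵀ *ᵥ c)) ^ 2)
      (gaussianPi (Fin n × Fin n)) := by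
  simp only [vecNorm_hadamard_sq]
  exact integrable_finsetSum _ fun i _ => integrable_dotProduct_pow_mul_pow _ _ 2 2

lemma integral_vecNorm_hadamard_sq (b c : Fin n → ℝ) :
    ∫ z, vecNorm 2 ((matrixOf z *ᵥ b) * ((matrixOf z)ᵀ *ᵥ c)) ^ 2 ∂gaussianPi (Fin n × Fin n) =
      n * ((b ⬝ᵥ b) * (c ⬝ᵥ c)) + 2 * ∑ i, (c i * b i) ^ 2 := by
  simp only [vecNorm_hadamard_sq]
  rw [integral_finsetSum _ fun i _ => integrable_dotProduct_pow_mul_pow _ _ 2 2]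
  simp [integral_dotProduct_sq_mul_sq, bilinCoeff_dotProduct_bilinCoeff, Finset.sum_add_distrib,
    Finset.mul_sum]

end MatrixMoments

section Invertible

variable {ι : Type*} [Fintype ι] [DecidableEq ι]

lemma finite_setOf_det_add_smul_one_eq_zero (M : Matrix ι ι ℝ) :
    {t : ℝ | (M + t • 1).det = 0}.Finite := by
  refine (Polynomial.finite_setOfPred_isRoot (-M).charpoly_monic.ne_zero).subset fun t ht => ?_
  rw [Set.mem_ofPred_eq, Polynomial.IsRoot, Matrix.eval_charpoly, sub_neg_eq_add, add_comm,
    Matrix.scalar_apply, ← Matrix.smul_one_eq_diagonal]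
  exact ht

lemma ae_isUnit_matrixOf : ∀ᵐ z ∂gaussianPi (ι × ι), IsUnit (matrixOf z) := by
  have hac : gaussianPi (ι × ι) ≪ volume := by
    rw [gaussianPi_eq_withDensity]
    exact withDensity_absolutelyContinuous _ _
  refine hac.ae_le ?_
  simp only [Matrix.isUnit_iff_isUnit_det, isUnit_iff_ne_zero]
  let e : ι × ι → ℝ := Function.uncurry (1 : Matrix ι ι ℝ)
  have hdet : Continuous fun z : ι × ι → ℝ => (matrixOf z).det :=
    Continuous.matrix_det (continuous_matrix fun i j => continuous_apply (i, j))
  refine ae_mem_of_ae_add_linearMap_mem (LinearMap.toSpanSingleton ℝ _ e) volume volume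
    (s := {z | (matrixOf z).det ≠ 0})
    ((isClosed_singleton.preimage hdet).isOpen_compl.measurableSet) fun z => ?_
  exact (finite_setOf_det_add_smul_one_eq_zero (matrixOf z)).countable.ae_notMem volume

end Invertible

namespace IsStdGaussianMatrix

variable {Ω : Type*} [MeasurableSpace Ω] {P : Measure Ω} {n : ℕ}
  {G : Ω → Matrix (Fin n) (Fin n) ℝ}

lemma hasLaw (hG : IsStdGaussianMatrix P G) :
    HasLaw (fun ω (ij : Fin n × Fin n) => G ω ij.1 ij.2) (gaussianPi (Fin n × Fin n)) P :=
  hG.indep.hasLaw_pi fun ij => hG.law ij.1 ij.2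

lemma ae_isUnit (hG : IsStdGaussianMatrix P G) : ∀ᵐ ω ∂P, IsUnit (G ω) := by
  have h := ae_isUnit_matrixOf (ι := Fin n)
  rw [← hG.hasLaw.map_eq] at h
  exact ae_of_ae_map hG.hasLaw.aemeasurable h

lemma ae_inv_inv (hG : IsStdGaussianMatrix P G) : ∀ᵐ ω ∂P, (G ω)⁻¹⁻¹ = G ω := by
  filter_upwards [hG.ae_isUnit] with ω hω
  exact Matrix.nonsing_inv_nonsing_inv _ ((Matrix.isUnit_iff_isUnit_det _).1 hω)

lemma integrable_comp_inv_inv (hG : IsStdGaussianMatrix P G) {h : Matrix (Fin n) (Fin n) ℝ → ℝ}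
    (hi : Integrable (fun z => h (matrixOf z)) (gaussianPi (Fin n × Fin n))) :
    Integrable (fun ω => h (G ω)⁻¹⁻¹) P := by
  rw [← hG.hasLaw.map_eq] at hi
  refine (hi.comp_aemeasurable hG.hasLaw.aemeasurable).congr ?_
  filter_upwards [hG.ae_inv_inv] with ω hω
  rw [hω]
  rfl

lemma integral_comp_inv_inv (hG : IsStdGaussianMatrix P G) {h : Matrix (Fin n) (Fin n) ℝ → ℝ}
    (hi : Integrable (fun z => h (matrixOf z)) (gaussianPi (Fin n × Fin n))) :
    ∫ ω, h (G ω)⁻¹⁻¹ ∂P = ∫ z, h (matrixOf z) ∂gaussianPi (Fin n × Fin n) := by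
  rw [← hG.hasLaw.integral_comp hi.aestronglyMeasurable]
  refine integral_congr_ae ?_
  filter_upwards [hG.ae_inv_inv] with ω hω
  rw [hω]
  rfl

lemma one_sub_exp_le_measureReal_inv_inv (hG : IsStdGaussianMatrix P G) {ε : ℝ} (hε : 0 < ε) :
    1 - Real.exp (-ε ^ 2 / 2) ≤ P.real {ω | matNorm 2 (G ω)⁻¹⁻¹ ≤ 2 * √n + ε} := by
  rw [two_mul]
  refine (one_sub_exp_le_measureReal_matNorm_two_matrixOf_le (m := n) (n := n) hε).trans_eq ?_
  rw [← hG.hasLaw.measureReal_eq (p := fun z => matNorm 2 (matrixOf z) ≤ √n + √n + ε)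
    (measurableSet_le (continuous_matNorm_matrixOf 2).measurable measurable_const)]
  refine measureReal_congr ?_
  filter_upwards [hG.ae_inv_inv] with ω hω
  change (matNorm 2 (G ω) ≤ √n + √n + ε) = (matNorm 2 (G ω)⁻¹⁻¹ ≤ √n + √n + ε)
  rw [hω]

end IsStdGaussianMatrix

section Asymptotics

variable {n : ℕ}

lemma vecNorm_infty_sq_le_dotProduct_self (v : Fin n → ℝ) : vecNorm ∞ v ^ 2 ≤ v ⬝ᵥ v := by
  have hnorm : vecNorm ∞ v = ‖v‖ := PiLp.norm_toLp v
  rw [hnorm, ← Real.le_sqrt (norm_nonneg v) (dotProduct_self_nonneg v),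
    pi_norm_le_iff_of_nonneg (Real.sqrt_nonneg _)]
  refine fun i => Real.abs_le_sqrt ?_
  rw [sq]
  exact Finset.single_le_sum (f := fun i => v i * v i) (fun j _ => mul_self_nonneg (v j))
    (Finset.mem_univ i)

lemma dotProduct_self_le_vecNorm_one_sq (v : Fin n → ℝ) : v ⬝ᵥ v ≤ vecNorm 1 v ^ 2 := by
  have hnorm : vecNorm 1 v = ∑ i, |v i| := by simp [vecNorm, PiLp.norm_eq_of_L1]
  simpa [hnorm, dotProduct, ← sq] using
    Finset.sum_sq_le_sq_sum_of_nonneg (s := Finset.univ) (f := fun i => |v i|)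
      fun i _ => abs_nonneg (v i)

lemma matNorm_one_le (p : ℝ≥0∞) [Fact (1 ≤ p)] : matNorm p (1 : Matrix (Fin n) (Fin n) ℝ) ≤ 1 := by
  rw [matNorm, Matrix.toLpLin_one]
  exact ContinuousLinearMap.norm_id_le

lemma isBigO_of_nonneg_of_le {α : Type*} {l : Filter α} {f g : α → ℝ} (hf : ∀ x, 0 ≤ f x)
    (hfg : ∀ x, f x ≤ g x) : f =O[l] g :=
  IsBigO.of_norm_le fun x => (Real.norm_of_nonneg (hf x)).trans_le (hfg x)

variable {b c : ∀ n : ℕ, Fin n → ℝ}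

lemma isBigO_dotProduct_self_mul (hb : (fun n => vecNorm 1 (b n)) =O[atTop] fun _ => (1 : ℝ))
    (hc : (fun n => vecNorm 1 (c n)) =O[atTop] fun _ => (1 : ℝ)) :
    (fun n => (c n ⬝ᵥ c n) * (b n ⬝ᵥ b n)) =O[atTop] fun _ => (1 : ℝ) := by
  refine (isBigO_of_nonneg_of_le
    (fun n => mul_nonneg (dotProduct_self_nonneg _) (dotProduct_self_nonneg _))
    (fun n => mul_le_mul (dotProduct_self_le_vecNorm_one_sq (c n))
      (dotProduct_self_le_vecNorm_one_sq (b n)) (dotProduct_self_nonneg _) (sq_nonneg _))).trans ?_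
  simpa using (hc.pow 2).mul (hb.pow 2)

lemma one_isBigO_dotProduct_self_mul
    (hb : (fun _ => (1 : ℝ)) =O[atTop] fun n => vecNorm ∞ (b n))
    (hc : (fun _ => (1 : ℝ)) =O[atTop] fun n => vecNorm ∞ (c n)) :
    (fun _ => (1 : ℝ)) =O[atTop] fun n => (b n ⬝ᵥ b n) * (c n ⬝ᵥ c n) := by
  have hinfty : (fun _ => (1 : ℝ)) =O[atTop]
      fun n => vecNorm ∞ (b n) ^ 2 * vecNorm ∞ (c n) ^ 2 := by
    simpa using (hb.pow 2).mul (hc.pow 2)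
  exact hinfty.trans <| isBigO_of_nonneg_of_le (fun n => by positivity) fun n =>
    mul_le_mul (vecNorm_infty_sq_le_dotProduct_self (b n))
      (vecNorm_infty_sq_le_dotProduct_self (c n)) (sq_nonneg _) (dotProduct_self_nonneg _)

lemma isBigO_sqrt_add_sqrt_add (C : ℝ) :
    (fun n : ℕ => √(n : ℝ) + √(n : ℝ) + C) =O[atTop] fun n : ℕ => (n : ℝ) ^ (1 / 2 : ℝ) := by
  simp only [← Real.sqrt_eq_rpow]
  have hone : (fun _ => (1 : ℝ)) =O[atTop] fun n : ℕ => √(n : ℝ) := by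
    refine IsBigO.of_bound 1 ?_
    filter_upwards [eventually_ge_atTop 1] with n hn
    simpa [abs_of_nonneg, Real.one_le_sqrt] using hn
  exact ((isBigO_refl _ _).add (isBigO_refl _ _)).add ((isBigO_const_one ℝ C _).trans hone)

end Asymptotics

section GaussianFamily

variable {Ω : Type*} {f : ℝ → ℝ} {b c : ∀ n : ℕ, Fin n → ℝ}
  {G : ∀ n : ℕ, Ω → Matrix (Fin n) (Fin n) ℝ}

lemma gradVec_gaussianFamily (n : ℕ) (ω : Ω) :
    ((gaussianFamily f b c G).sys n ω).gradVec ((gaussianFamily f b c G).c n) =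
      ((G n ω)⁻¹⁻¹ *ᵥ b n) * (((G n ω)⁻¹⁻¹)ᵀ *ᵥ c n) := by
  simp [gaussianFamily, RandomDesignFamily.sys, PhysicalSystem.gradVec]

lemma overlap_gaussianFamily (n : ℕ) (ω : Ω) :
    ((gaussianFamily f b c G).sys n ω).overlap ((gaussianFamily f b c G).c n) =
      c n ⬝ᵥ (G n ω)⁻¹⁻¹ *ᵥ b n := rfl

variable [MeasurableSpace Ω] {P : Measure Ω}

lemma integrable_gradVec_gaussianFamily_sq (hG : ∀ n, IsStdGaussianMatrix P (G n)) (n : ℕ) :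
    Integrable (fun ω => vecNorm 2 (((gaussianFamily f b c G).sys n ω).gradVec
      ((gaussianFamily f b c G).c n)) ^ 2) P := by
  simp only [gradVec_gaussianFamily]
  exact (hG n).integrable_comp_inv_inv (h := fun M => vecNorm 2 ((M *ᵥ b n) * (Mᵀ *ᵥ c n)) ^ 2)
    (integrable_vecNorm_hadamard_sq (b n) (c n))

lemma integral_gradVec_gaussianFamily_sq (hG : ∀ n, IsStdGaussianMatrix P (G n)) (n : ℕ) :
    ∫ ω, vecNorm 2 (((gaussianFamily f b c G).sys n ω).gradVec
      ((gaussianFamily f b c G).c n)) ^ 2 ∂P =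
      n * ((b n ⬝ᵥ b n) * (c n ⬝ᵥ c n)) + 2 * ∑ i, (c n i * b n i) ^ 2 := by
  simp only [gradVec_gaussianFamily]
  rw [← integral_vecNorm_hadamard_sq]
  exact (hG n).integral_comp_inv_inv (h := fun M => vecNorm 2 ((M *ᵥ b n) * (Mᵀ *ᵥ c n)) ^ 2)
    (integrable_vecNorm_hadamard_sq (b n) (c n))

lemma natCast_isBigO_integral_gradVec_gaussianFamily_sq (hG : ∀ n, IsStdGaussianMatrix P (G n))
    (hb : (fun _ => (1 : ℝ)) =O[atTop] fun n => vecNorm ∞ (b n))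
    (hc : (fun _ => (1 : ℝ)) =O[atTop] fun n => vecNorm ∞ (c n)) :
    (fun n : ℕ => (n : ℝ)) =O[atTop] fun n => ∫ ω, vecNorm 2
      (((gaussianFamily f b c G).sys n ω).gradVec ((gaussianFamily f b c G).c n)) ^ 2 ∂P := by
  have hmain : (fun n : ℕ => (n : ℝ)) =O[atTop]
      fun n => (n : ℝ) * ((b n ⬝ᵥ b n) * (c n ⬝ᵥ c n)) := by
    simpa using (isBigO_refl (fun n : ℕ => (n : ℝ)) atTop).mul
      (one_isBigO_dotProduct_self_mul hb hc)
  simp only [integral_gradVec_gaussianFamily_sq hG]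
  exact hmain.trans <| isBigO_of_nonneg_of_le
    (fun n => mul_nonneg n.cast_nonneg
      (mul_nonneg (dotProduct_self_nonneg _) (dotProduct_self_nonneg _)))
    fun n => le_add_of_nonneg_right (by positivity)

lemma integrable_overlap_gaussianFamily_sq (hG : ∀ n, IsStdGaussianMatrix P (G n)) (n : ℕ) :
    Integrable (fun ω => |((gaussianFamily f b c G).sys n ω).overlap
      ((gaussianFamily f b c G).c n)| ^ 2) P := by
  simp only [overlap_gaussianFamily, sq_abs]
  exact (hG n).integrable_comp_inv_inv (h := fun M => (c n ⬝ᵥ M *ᵥ b n) ^ 2)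
    (integrable_dotProduct_mulVec_sq (c n) (b n))

lemma integral_overlap_gaussianFamily_sq (hG : ∀ n, IsStdGaussianMatrix P (G n)) (n : ℕ) :
    ∫ ω, |((gaussianFamily f b c G).sys n ω).overlap ((gaussianFamily f b c G).c n)| ^ 2 ∂P =
      (c n ⬝ᵥ c n) * (b n ⬝ᵥ b n) := by
  simp only [overlap_gaussianFamily, sq_abs]
  rw [← integral_dotProduct_mulVec_sq]
  exact (hG n).integral_comp_inv_inv (h := fun M => (c n ⬝ᵥ M *ᵥ b n) ^ 2)
    (integrable_dotProduct_mulVec_sq (c n) (b n))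

lemma isBigO_integral_overlap_gaussianFamily_sq (hG : ∀ n, IsStdGaussianMatrix P (G n))
    (hb : (fun n => vecNorm 1 (b n)) =O[atTop] fun _ => (1 : ℝ))
    (hc : (fun n => vecNorm 1 (c n)) =O[atTop] fun _ => (1 : ℝ)) :
    (fun n => ∫ ω, |((gaussianFamily f b c G).sys n ω).overlap
      ((gaussianFamily f b c G).c n)| ^ 2 ∂P) =O[atTop] fun _ => (1 : ℝ) := by
  simpa only [integral_overlap_gaussianFamily_sq hG] using isBigO_dotProduct_self_mul hb hc

lemma integrable_abs_overlap_gaussianFamily (hG : ∀ n, IsStdGaussianMatrix P (G n)) (n : ℕ) :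
    Integrable (fun ω => |((gaussianFamily f b c G).sys n ω).overlap
      ((gaussianFamily f b c G).c n)|) P :=
  (hG n).integrable_comp_inv_inv (h := fun M => |c n ⬝ᵥ M *ᵥ b n|)
    (integrable_dotProduct_mulVec (c n) (b n)).abs

lemma isBigO_integral_abs_overlap_gaussianFamily (hG : ∀ n, IsStdGaussianMatrix P (G n))
    (hb : (fun n => vecNorm 1 (b n)) =O[atTop] fun _ => (1 : ℝ))
    (hc : (fun n => vecNorm 1 (c n)) =O[atTop] fun _ => (1 : ℝ)) :
    (fun n => ∫ ω, |((gaussianFamily f b c G).sys n ω).overlap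
      ((gaussianFamily f b c G).c n)| ∂P) =O[atTop] fun _ => (1 : ℝ) :=
  (isBigO_of_nonneg_of_le (fun _ => integral_nonneg fun _ => abs_nonneg _) fun n =>
    ((hG n).integral_comp_inv_inv (h := fun M => |c n ⬝ᵥ M *ᵥ b n|)
      (integrable_dotProduct_mulVec (c n) (b n)).abs).trans_le
      (integral_abs_dotProduct_mulVec_le (c n) (b n))).trans
    ((isBigO_refl _ _).add (isBigO_dotProduct_self_mul hb hc))

lemma isBigO_integral_matNorm_two_inv_inv (hG : ∀ n, IsStdGaussianMatrix P (G n)) :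
    (fun n => ∫ ω, matNorm 2 (G n ω)⁻¹⁻¹ ∂P) =O[atTop] fun n : ℕ => (n : ℝ) ^ (1 / 2 : ℝ) :=
  (isBigO_of_nonneg_of_le (fun _ => integral_nonneg fun _ => matNorm_nonneg 2 _) fun n =>
    ((hG n).integral_comp_inv_inv (integrable_matNorm_matrixOf 2)).trans_le
      integral_matNorm_two_matrixOf_le).trans (isBigO_sqrt_add_sqrt_add (1 / 2))

theorem convergenceConditionsOnAverage_gaussianFamily {L : ℝ≥0} {μ : ℝ}
    (hf : IsAdmissibleCost f L μ)
    (hb_infty : (fun n => vecNorm ∞ (b n)) =Θ[atTop] fun _ => (1 : ℝ))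
    (hb_one : (fun n => vecNorm 1 (b n)) =O[atTop] fun _ => (1 : ℝ))
    (hc_infty : (fun n => vecNorm ∞ (c n)) =Θ[atTop] fun _ => (1 : ℝ))
    (hc_one : (fun n => vecNorm 1 (c n)) =O[atTop] fun _ => (1 : ℝ))
    (hG : ∀ n, IsStdGaussianMatrix P (G n)) :
    (gaussianFamily f b c G).ConvergenceConditionsOnAverage P (1 / 2) (1 / 2) := by
  have hB (p : ℝ≥0∞) [Fact (1 ≤ p)] :
      (fun n => matNorm p ((gaussianFamily f b c G).B n)) =O[atTop] fun _ => (1 : ℝ) :=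
    isBigO_of_nonneg_of_le (fun _ => matNorm_nonneg p _) fun _ => matNorm_one_le p
  exact
    { cost := ⟨L, μ, hf⟩
      invertible := fun n => (hG n).ae_isUnit.mono fun _ => Matrix.isUnit_nonsing_inv_iff.2
      inv_integrable := fun n => (hG n).integrable_comp_inv_inv (integrable_matNorm_matrixOf 2)
      inv_bound := isBigO_integral_matNorm_two_inv_inv hG
      B_infty := hB ∞
      B_one := hB 1
      B_two := hB 2
      b_infty := hb_infty.1
      b_one := hb_one
      c_infty := hc_infty.1
      c_one := hc_one
      grad_integrable := integrable_gradVec_gaussianFamily_sq hG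
      grad_bound := by
        simpa only [add_halves, Real.rpow_one] using
          natCast_isBigO_integral_gradVec_gaussianFamily_sq hG hb_infty.2 hc_infty.2
      overlap_integrable := integrable_abs_overlap_gaussianFamily hG
      overlap_bound := isBigO_integral_abs_overlap_gaussianFamily hG hb_one hc_one }

end GaussianFamily

theorem proposition1 {Ω : Type*} [MeasurableSpace Ω] (P : Measure Ω) [IsProbabilityMeasure P]
    (f : ℝ → ℝ) (L : ℝ≥0) (μ : ℝ) (hf : IsAdmissibleCost f L μ)
    (b c : ∀ n : ℕ, Fin n → ℝ)
    (hb_infty : (fun n => vecNorm ∞ (b n)) =Θ[atTop] fun _ => (1 : ℝ))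
    (hb_one : (fun n => vecNorm 1 (b n)) =Θ[atTop] fun _ => (1 : ℝ))
    (hc_infty : (fun n => vecNorm ∞ (c n)) =Θ[atTop] fun _ => (1 : ℝ))
    (hc_one : (fun n => vecNorm 1 (c n)) =Θ[atTop] fun _ => (1 : ℝ))
    (G : ∀ n : ℕ, Ω → Matrix (Fin n) (Fin n) ℝ) (hG : ∀ n, IsStdGaussianMatrix P (G n))
    (F : RandomDesignFamily Ω (fun n => n)) (hF : F = gaussianFamily f b c G) :
    (∀ n, ∀ᵐ ω ∂P, IsUnit (G n ω)) ∧
    (∀ n : ℕ, ∀ ε : ℝ, 0 < ε →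
      1 - 2 * Real.exp (-ε ^ 2 / 2) ≤
        P.real {ω | matNorm 2 (F.A n ω)⁻¹ ≤ 2 * Real.sqrt n + ε}) ∧
    ((∀ n, Integrable (fun ω => vecNorm 2 ((F.sys n ω).gradVec (F.c n)) ^ 2) P) ∧
      (fun n : ℕ => (n : ℝ)) =O[atTop]
        fun n => ∫ ω, vecNorm 2 ((F.sys n ω).gradVec (F.c n)) ^ 2 ∂P) ∧
    ((∀ n, Integrable (fun ω => |(F.sys n ω).overlap (F.c n)| ^ 2) P) ∧
      (fun n => ∫ ω, |(F.sys n ω).overlap (F.c n)| ^ 2 ∂P) =O[atTop] fun _ => (1 : ℝ)) ∧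
    F.ConvergenceConditionsOnAverage P (1 / 2) (1 / 2) := by
  subst hF
  refine ⟨fun n => (hG n).ae_isUnit, fun n ε hε => ?_,
    ⟨integrable_gradVec_gaussianFamily_sq hG,
      natCast_isBigO_integral_gradVec_gaussianFamily_sq hG hb_infty.2 hc_infty.2⟩,
    ⟨integrable_overlap_gaussianFamily_sq hG,
      isBigO_integral_overlap_gaussianFamily_sq hG hb_one.1 hc_one.1⟩,
    convergenceConditionsOnAverage_gaussianFamily hf hb_infty hb_one.1 hc_infty hc_one.1 hG⟩
  calc 1 - 2 * Real.exp (-ε ^ 2 / 2) ≤ 1 - Real.exp (-ε ^ 2 / 2) := by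
        linarith [Real.exp_pos (-ε ^ 2 / 2)]
    _ ≤ P.real {ω | matNorm 2 (G n ω)⁻¹⁻¹ ≤ 2 * √n + ε} :=
        (hG n).one_sub_exp_le_measureReal_inv_inv hε
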